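/- **Setting.** Let $(\Omega,\mathcal A,\mathbb P)$ be a probability space, $(E,\mathcal T)$ a measurable space, $X=(X_i)_{i\ge1}$ a stationary $E$-valued process, $T$ the shift on $E^{\mathbb N_+}$, and $d\ge1$. For each $n\ge1$ let $S_n\Phi:E^{\mathbb N_+}\to\mathbb R^d$ be measurable. Let $(k(n))_{n\ge1}$ be a non-decreasing sequence of positive integers. For $\lambda\in\mathbb R^d$ put $$\Lambda_n(\lambda)=\tfrac1n\log\mathbb E\,e^{\langle\lambda,S_n\Phi(X)\rangle}\in(-\infty,+\infty],\qquad \mu_n^\omega=\frac1{k(n)}\sum_{j=1}^{k(n)}\delta_{S_n\Phi(T^{(j-1)n}X(\omega))/n},\qquad \Lambda_n^\omega(\lambda)=\tfrac1n\log\int_{\mathbb R^d}e^{n\langle\lambda,x\rangle}\,d\mu_n^\omega(x).$$ For sub-$\sigma$-algebras $\mathcal U,\mathcal V$ let $\alpha(\mathcal U,\mathcal V)=\sup\{|\mathbb P(U)\mathbb P(V)-\mathbb P(U\cap V)|:U\in\mathcal U,V\in\mathcal V\}$, and for $m\ge1$ let $\alpha_{X,m}=\sup_{i\ge1}\alpha(\sigma(X_k:k\le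 i),\sigma(X_j:j\ge i+m))$. **Assumptions.** - (A1') There is a convex open set $\mathcal D\subset\mathbb R^d$ such that $\Lambda(\lambda)=\lim_n\Lambda_n(\lambda)$ exists and is finite for every $\lambda\in\mathcal D$. - (A2') There are $\gamma,\theta>0$ with $\alpha_{X,m}=O(\exp(-\gamma m^\theta))$ as $m\to\infty$. - (A3) There are measurable functions $S_n\Phi_n:E^{\mathbb N_+}\to\mathbb R^d$, each depending only on the first $2n$ coordinates, with $\|S_n\Phi-S_n\Phi_n\|_\infty/n\to0$, where $\|\cdot\|_\infty$ is the supremum over all of $E^{\mathbb N_+}$. - $\Lambda$ is of class $C^2$ on $\mathcal D$. **Notation.** Outside $\mathcal D$ put $\Lambda=\limsup_n\Lambda_n$, and let $\Lambda^*(x)=\sup_{\lambda\in\mathbb R^d}(\langle\lambda,x\rangle-\Lambda(\lambda))$. For $B\subset\mathcal D$ let $$\varLambda^*(B)=\sup_{\lambda\in B}\Lambda^*(\nabla\Lambda(\lambda)),\quad \xi_1(B)=\sup_{\lambda\in B}\|\nabla\Lambda(\lambda)\|,\quad \xi_2(B)=\sup_{\lambda\in B}\tfrac12\,{}^t\lambda\,D^2\Lambda(\lambda)\,\lambda,\quad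 \xi(B)=\varLambda^*(B)+\xi_2(B),$$ $$\delta_n\Lambda(B)=\sup_{\lambda\in B}|\Lambda(\lambda)-\Lambda_n(\lambda)|,\quad \delta_n\Phi(B)=\Big(\sup_{\lambda\in B}\|\lambda\|\Big)\frac{\|S_n\Phi-S_n\Phi_n\|_\infty}{n},\quad \delta_n(\Lambda,\Phi)(B)=\delta_n\Lambda(B)+\delta_n\Phi(B),$$ and let $B_\rho=\{\lambda\in\mathbb R^d:d(\lambda,B)\le\rho\}$ for the Euclidean distance. **Theorem 2.4.** Assume the above. Let $B\subset\mathcal D$ be compact and $\rho>0$ with $B_\rho\subset\mathcal D$, and suppose that $(\epsilon_n)_{n\ge1}$ is a positive sequence converging to $0$ such that $$\sum_{n\ge1}\exp\!\big(-\sqrt{\epsilon_n}\,[\log k(n)-n\varLambda^*(B)]\big)\,\epsilon_n^{-(d+3/2)}\exp\!\big(3n[\xi(B_\rho)\epsilon_n+\delta_n(\Lambda,\Phi)(B_\rho)]\big)<\infty.\tag{BC}$$ Then for every $\eta>0$, with probability $1$, for all sufficiently large $n$, $$\max_{\lambda\in B}|\Lambda_n^\omega(\lambda)-\Lambda(\lambda)|\le(\eta+2\xi_1(B))\,\epsilon_n+\delta_n\Lambda(B_\rho)+2\,\delta_n\Phi(B).$$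 If moreover $B$ consists of a single point, then with probability $1$, for all sufficiently large $n$, the same maximum is at most $$\frac{\epsilon_n(1+\epsilon_n)}{n}+\delta_n\Lambda(B_\rho)+2\,\delta_n\Phi(B).$$ -/

import Mathlib

open MeasureTheory Filter Topology
open scoped ENNReal

noncomputable section

namespace LocalFluct

section Mixing

variable {Ω : Type*} [MeasurableSpace Ω] {E : Type*} [mE : MeasurableSpace E]

/-- The strong mixing coefficient of two sub-σ-algebras,
`sup {|P(U) P(V) - P(U ∩ V)| : U ∈ 𝓤, V ∈ 𝓥}` (the supremum of a nonempty subset of `[0, 1]`). -/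
def alphaCoeff (P : Measure Ω) (𝓤 𝓥 : MeasurableSpace Ω) : ℝ :=
  sSup {r : ℝ | ∃ U V : Set Ω, MeasurableSet[𝓤] U ∧ MeasurableSet[𝓥] V ∧
    r = |P.real U * P.real V - P.real (U ∩ V)|}

/-- The mixing coefficients `α_{X,m}` of a process. The coordinates are numbered from `0`:
`X 0` is the first variable. -/
def alphaMix (P : Measure Ω) (X : ℕ → Ω → E) (m : ℕ) : ℝ :=
  if m = 0 then 1 / 2 else
    ⨆ i : ℕ, alphaCoeff P (⨆ k : {k : ℕ // k ≤ i}, mE.comap (X k))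
      (⨆ j : {j : ℕ // i + m ≤ j}, mE.comap (X j))

/-- `α_{X,m} = O(exp(-γ m^θ))` for some `γ, θ > 0`. -/
def StretchedExpMixing (P : Measure Ω) (X : ℕ → Ω → E) : Prop :=
  ∃ γ θ : ℝ, 0 < γ ∧ 0 < θ ∧
    (fun m : ℕ => alphaMix P X m) =O[atTop] (fun m : ℕ => Real.exp (-γ * (m : ℝ) ^ θ))

/-- The path of the process as a point of the sequence space. -/
def path (X : ℕ → Ω → E) (ω : Ω) : ℕ → E := fun i => X i ω

/-- (Strict) stationarity: the shifted process has the same law on the sequence space. -/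
def Stationary (P : Measure Ω) (X : ℕ → Ω → E) : Prop :=
  P.map (path fun i => X (i + 1)) = P.map (path X)

end Mixing

section Main

variable {Ω : Type*} [MeasurableSpace Ω] {E : Type*} [MeasurableSpace E] {d : ℕ}

/-- The `m`-th iterate `T^m` of the shift on sequences. -/
def shift (m : ℕ) (z : ℕ → E) : ℕ → E := fun i => z (i + m)

/-- `Λ_n(l) = (1/n) log 𝔼 exp⟨l, S_n(X)⟩`, with value `+∞` if the expectation is infinite. -/
def LambdaN (P : Measure Ω) (X : ℕ → Ω → E)
    (S : ℕ → (ℕ → E) → EuclideanSpace ℝ (Fin d)) (n : ℕ) (l : EuclideanSpace ℝ (Fin d)) : EReal :=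
  ENNReal.log (∫⁻ ω, ENNReal.ofReal (Real.exp (inner ℝ l (S n (path X ω)))) ∂P) / (n : EReal)

/-- `Λ(l)`. This is `lim Λ_n(l)` wherever that limit exists, in particular on the domain `𝒟` below.
(At a point without limit the upper limit is taken, a choice that does not affect
`Λ^*` at the gradients of `Λ` on `𝒟`, by convexity.) -/
def LambdaLim (P : Measure Ω) (X : ℕ → Ω → E)
    (S : ℕ → (ℕ → E) → EuclideanSpace ℝ (Fin d)) (l : EuclideanSpace ℝ (Fin d)) : EReal :=
  limsup (fun n : ℕ => LambdaN P X S n l) atTop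

/-- `Λ` as a real-valued function, for use where it is finite. -/
def LambdaReal (P : Measure Ω) (X : ℕ → Ω → E)
    (S : ℕ → (ℕ → E) → EuclideanSpace ℝ (Fin d)) (l : EuclideanSpace ℝ (Fin d)) : ℝ :=
  (LambdaLim P X S l).toReal

/-- `Λ(l) = lim Λ_n(l)` exists and is finite for each `l ∈ D`, where `D` is convex and open. -/
def HasFiniteLimitOn (P : Measure Ω) (X : ℕ → Ω → E)
    (S : ℕ → (ℕ → E) → EuclideanSpace ℝ (Fin d)) (D : Set (EuclideanSpace ℝ (Fin d))) : Prop :=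
  Convex ℝ D ∧ IsOpen D ∧
    ∀ l ∈ D, ∃ r : ℝ, Tendsto (fun n : ℕ => LambdaN P X S n l) atTop (𝓝 (r : EReal))

/-- `‖S_n - S'_n‖_∞ / n`. -/
def approxErr (S S' : ℕ → (ℕ → E) → EuclideanSpace ℝ (Fin d)) (n : ℕ) : ℝ≥0∞ :=
  (⨆ z : ℕ → E, ‖S n z - S' n z‖ₑ) / (n : ℝ≥0∞)

/-- Each `S'_n` (`n ≥ 1`) is a measurable function of the `2n` first coordinates only, and
`‖S_n - S'_n‖_∞ / n` tends to `0`. -/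
def LocalApprox (S S' : ℕ → (ℕ → E) → EuclideanSpace ℝ (Fin d)) : Prop :=
  (∀ n, 1 ≤ n → Measurable (S' n) ∧ DependsOn (S' n) (Set.Iio (2 * n))) ∧
    Tendsto (approxErr S S') atTop (𝓝 0)

/-- The empirical measure `μ_n^ω` of the `k(n)` points `S_n(T^{jn} X(ω)) / n`, `0 ≤ j < k(n)`. -/
def empMeasure (X : ℕ → Ω → E) (S : ℕ → (ℕ → E) → EuclideanSpace ℝ (Fin d)) (k : ℕ → ℕ)
    (n : ℕ) (ω : Ω) : Measure (EuclideanSpace ℝ (Fin d)) :=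
  (k n : ℝ≥0∞)⁻¹ • ∑ j ∈ Finset.range (k n),
    Measure.dirac ((n : ℝ)⁻¹ • S n (shift (j * n) (path X ω)))

/-- `Λ_n^ω(l) = (1/n) log ∫ exp(n⟨l, x⟩) dμ_n^ω(x)`. -/
def LambdaEmp (X : ℕ → Ω → E) (S : ℕ → (ℕ → E) → EuclideanSpace ℝ (Fin d)) (k : ℕ → ℕ)
    (n : ℕ) (ω : Ω) (l : EuclideanSpace ℝ (Fin d)) : ℝ :=
  (1 / (n : ℝ)) * Real.log (∫ x, Real.exp (n * inner ℝ l x) ∂(empMeasure X S k n ω))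

/-- The Fenchel-Legendre transform `Λ^*(x) = sup {⟨l, x⟩ - Λ(l) : l ∈ ℝ^d}`. -/
def LambdaStar (P : Measure Ω) (X : ℕ → Ω → E)
    (S : ℕ → (ℕ → E) → EuclideanSpace ℝ (Fin d)) (x : EuclideanSpace ℝ (Fin d)) : EReal :=
  ⨆ l : EuclideanSpace ℝ (Fin d), ((inner ℝ l x : ℝ) : EReal) - LambdaLim P X S l

/-- `sup {Λ^*(∇Λ(l)) : l ∈ B}`. -/
def LambdaStarSup (P : Measure Ω) (X : ℕ → Ω → E)
    (S : ℕ → (ℕ → E) → EuclideanSpace ℝ (Fin d)) (B : Set (EuclideanSpace ℝ (Fin d))) : EReal :=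
  ⨆ l ∈ B, LambdaStar P X S (gradient (LambdaReal P X S) l)

/-- `ξ₁(B) = sup {‖∇Λ(l)‖ : l ∈ B}`. -/
def xi1 (P : Measure Ω) (X : ℕ → Ω → E)
    (S : ℕ → (ℕ → E) → EuclideanSpace ℝ (Fin d)) (B : Set (EuclideanSpace ℝ (Fin d))) : ℝ≥0∞ :=
  ⨆ l ∈ B, ‖gradient (LambdaReal P X S) l‖ₑ

/-- `ξ₂(B) = sup {(1/2) D²Λ(l)(l, l) : l ∈ B}`. -/
def xi2 (P : Measure Ω) (X : ℕ → Ω → E)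
    (S : ℕ → (ℕ → E) → EuclideanSpace ℝ (Fin d)) (B : Set (EuclideanSpace ℝ (Fin d))) : EReal :=
  ⨆ l ∈ B, ((1 / 2 * fderiv ℝ (fderiv ℝ (LambdaReal P X S)) l l l : ℝ) : EReal)

/-- `ξ(B) = sup {Λ^*(∇Λ(l)) : l ∈ B} + ξ₂(B)`. -/
def xi (P : Measure Ω) (X : ℕ → Ω → E)
    (S : ℕ → (ℕ → E) → EuclideanSpace ℝ (Fin d)) (B : Set (EuclideanSpace ℝ (Fin d))) : EReal :=
  LambdaStarSup P X S B + xi2 P X S B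

/-- `δ_nΛ(B) = sup {|Λ(l) - Λ_n(l)| : l ∈ B}`. -/
def deltaLambda (P : Measure Ω) (X : ℕ → Ω → E)
    (S : ℕ → (ℕ → E) → EuclideanSpace ℝ (Fin d)) (B : Set (EuclideanSpace ℝ (Fin d)))
    (n : ℕ) : ℝ≥0∞ :=
  ⨆ l ∈ B, (LambdaLim P X S l - LambdaN P X S n l).abs

/-- `δ_nΦ(B) = (sup {‖l‖ : l ∈ B}) ‖S_n - S'_n‖_∞ / n`. -/
def deltaPhi (S S' : ℕ → (ℕ → E) → EuclideanSpace ℝ (Fin d))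
    (B : Set (EuclideanSpace ℝ (Fin d))) (n : ℕ) : ℝ≥0∞ :=
  (⨆ l ∈ B, ‖l‖ₑ) * approxErr S S' n

/-- `δ_n(Λ,Φ)(B) = δ_nΛ(B) + δ_nΦ(B)`. -/
def deltaTot (P : Measure Ω) (X : ℕ → Ω → E)
    (S S' : ℕ → (ℕ → E) → EuclideanSpace ℝ (Fin d)) (B : Set (EuclideanSpace ℝ (Fin d)))
    (n : ℕ) : ℝ≥0∞ :=
  deltaLambda P X S B n + deltaPhi S S' B n

/-- The `n`-th term of the series in the summability condition, with `Bρ` the closed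
`ρ`-neighbourhood of `B`:
`exp(-√ε_n [log k(n) - n sup_B Λ^*(∇Λ)]) ε_n^{-(d+3/2)} exp(3n[ξ(Bρ) ε_n + δ_n(Λ,Φ)(Bρ)])`. -/
def bcTerm (P : Measure Ω) (X : ℕ → Ω → E)
    (S S' : ℕ → (ℕ → E) → EuclideanSpace ℝ (Fin d)) (B Bρ : Set (EuclideanSpace ℝ (Fin d)))
    (k : ℕ → ℕ) (ε : ℕ → ℝ) (n : ℕ) : ℝ≥0∞ :=
  EReal.exp (-((Real.sqrt (ε n) : ℝ) : EReal) *
      (((Real.log (k n) : ℝ) : EReal) - (n : EReal) * LambdaStarSup P X S B)) *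
    ENNReal.ofReal (ε n ^ (-((d : ℝ) + 3 / 2))) *
    EReal.exp (3 * (n : EReal) *
      (xi P X S Bρ * ((ε n : ℝ) : EReal) + ((deltaTot P X S S' Bρ n : ℝ≥0∞) : EReal)))

end Main

end LocalFluct

end

open LocalFluct

/-! Fix `l` and write `Y_j` for `exp ⟨l, S'_n⟩` on the `j`-th block of length `n`. Since `S'_n`
depends on `2n` coordinates only, blocks far enough apart are nearly independent, and truncating the
`Y_j` gives a weak law of large numbers with rate, in terms of the moment of `Y_j` of order
`1 + √ε_n`. Expanding `Λ` along the ray through `l` to second order bounds this moment relative to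
`(𝔼 Y_j)^(1 + √ε_n)` by `exp (n (√ε_n Λ^*(∇Λ(l)) + ε_n ξ₂))`, up to the errors `δ_n(Λ,Φ)`. The
summability condition then makes the deviation probabilities summable even after multiplication by
the size of a net of `B` of mesh `o(ε_n)`, so Borel-Cantelli controls `Λ_n^ω - Λ_n`, both taken for
`S'_n`, on the whole net. These two functions are convex and, by the law of large numbers at
finitely many points, bounded near `B` independently of `n`; hence they are equi-Lipschitz there,
and the estimate passes from the net to `B`. Replacing `S'_n` by `S_n` costs `2 δ_nΦ`. -/

namespace LocalFluct

open ProbabilityTheory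

section MixingCoefficient

variable {Ω : Type*} {𝓤 𝓥 𝓤' 𝓥' : MeasurableSpace Ω} [mΩ : MeasurableSpace Ω] {P : Measure Ω}
  [IsProbabilityMeasure P]

theorem abs_measureReal_mul_sub_le_one (U V : Set Ω) :
    |P.real U * P.real V - P.real (U ∩ V)| ≤ 1 := by
  have hprod : P.real U * P.real V ∈ Set.Icc (0 : ℝ) 1 :=
    ⟨by positivity, mul_le_one₀ measureReal_le_one measureReal_nonneg measureReal_le_one⟩
  have hinter : P.real (U ∩ V) ∈ Set.Icc (0 : ℝ) 1 := ⟨measureReal_nonneg, measureReal_le_one⟩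
  simpa using Set.abs_sub_le_of_uIcc_subset_uIcc
    ((Set.uIcc_subset_Icc hinter hprod).trans Set.Icc_subset_uIcc)

theorem abs_measureReal_mul_sub_le_alphaCoeff {U V : Set Ω} (hU : MeasurableSet[𝓤] U)
    (hV : MeasurableSet[𝓥] V) :
    |P.real U * P.real V - P.real (U ∩ V)| ≤ alphaCoeff P 𝓤 𝓥 :=
  le_csSup ⟨1, by rintro _ ⟨U, V, -, -, rfl⟩; exact abs_measureReal_mul_sub_le_one U V⟩
    ⟨U, V, hU, hV, rfl⟩

theorem alphaCoeff_nonneg : 0 ≤ alphaCoeff P 𝓤 𝓥 :=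
  (abs_nonneg _).trans <|
    abs_measureReal_mul_sub_le_alphaCoeff (@MeasurableSet.empty _ 𝓤) (@MeasurableSet.empty _ 𝓥)

theorem alphaCoeff_le_iff {a : ℝ} : alphaCoeff P 𝓤 𝓥 ≤ a ↔ ∀ U V : Set Ω, MeasurableSet[𝓤] U →
    MeasurableSet[𝓥] V → |P.real U * P.real V - P.real (U ∩ V)| ≤ a := by
  refine ⟨fun h U V hU hV => (abs_measureReal_mul_sub_le_alphaCoeff hU hV).trans h, fun h => ?_⟩
  refine csSup_le ⟨_, ∅, ∅, @MeasurableSet.empty _ 𝓤, @MeasurableSet.empty _ 𝓥, rfl⟩ ?_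
  rintro _ ⟨U, V, hU, hV, rfl⟩
  exact h U V hU hV

theorem alphaCoeff_le_one : alphaCoeff P 𝓤 𝓥 ≤ 1 :=
  alphaCoeff_le_iff.2 fun U V _ _ => abs_measureReal_mul_sub_le_one U V

theorem alphaCoeff_mono (hU : 𝓤 ≤ 𝓤') (hV : 𝓥 ≤ 𝓥') :
    alphaCoeff P 𝓤 𝓥 ≤ alphaCoeff P 𝓤' 𝓥' :=
  alphaCoeff_le_iff.2 fun _ _ h h' => abs_measureReal_mul_sub_le_alphaCoeff (hU _ h) (hV _ h')

end MixingCoefficient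

section Covariance

variable {Ω : Type*} {𝓤 : MeasurableSpace Ω} [mΩ : MeasurableSpace Ω]

theorem abs_integral_sub_integral_le_of_superlevel {μ ν : Measure Ω} [IsFiniteMeasure μ]
    [IsFiniteMeasure ν] {f : Ω → ℝ} {M a : ℝ} (hM : 0 ≤ M) (hf : Measurable f)
    (hfM : ∀ ω, f ω ∈ Set.Icc 0 M)
    (h : ∀ t, |μ.real {ω | t ≤ f ω} - ν.real {ω | t ≤ f ω}| ≤ a) :
    |∫ ω, f ω ∂μ - ∫ ω, f ω ∂ν| ≤ a * M := by
  have layercake (κ : Measure Ω) [IsFiniteMeasure κ] :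
      ∫ ω, f ω ∂κ = ∫ t in Set.Ioc 0 M, κ.real {ω | t ≤ f ω} :=
    (Integrable.of_mem_Icc 0 M hf.aemeasurable (ae_of_all _ hfM)).integral_eq_integral_Ioc_meas_le
      (ae_of_all _ fun ω => (hfM ω).1) (ae_of_all _ fun ω => (hfM ω).2)
  have hint (κ : Measure Ω) [IsFiniteMeasure κ] :
      IntegrableOn (fun t => κ.real {ω | t ≤ f ω}) (Set.Ioc 0 M) := by
    refine IntegrableOn.mono_set (AntitoneOn.integrableOn_isCompact isCompact_Icc ?_)
      Set.Ioc_subset_Icc_self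
    exact fun s _ t _ hst => measureReal_mono fun ω => hst.trans
  rw [layercake μ, layercake ν, ← integral_sub (hint μ) (hint ν), ← Real.norm_eq_abs]
  refine (norm_setIntegral_le_of_norm_le_const measure_Ioc_lt_top fun t _ => h t).trans_eq ?_
  simp [hM]

theorem abs_measureReal_mul_integral_sub_setIntegral_le {P : Measure Ω} [IsProbabilityMeasure P]
    {Z : Ω → ℝ} {M : ℝ} {U : Set Ω} (hM : 0 ≤ M) (hZ : Measurable Z) (hZM : ∀ ω, Z ω ∈ Set.Icc 0 M)
    (hU : MeasurableSet[𝓤] U) :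
    |P.real U * P[Z] - ∫ ω in U, Z ω ∂P| ≤ alphaCoeff P 𝓤 (.comap Z inferInstance) * M := by
  have : IsFiniteMeasure (P U • P) := P.smul_finite (measure_ne_top _ _)
  have := abs_integral_sub_integral_le_of_superlevel (μ := P U • P) (ν := P.restrict U)
    (a := alphaCoeff P 𝓤 (.comap Z inferInstance)) hM hZ hZM fun s => ?_
  · simpa [integral_smul_measure, measureReal_def] using this
  · rw [measureReal_ennreal_smul_apply, measureReal_restrict_apply
      (measurableSet_le measurable_const hZ), ← measureReal_def, Set.inter_comm]
    exact abs_measureReal_mul_sub_le_alphaCoeff hU ⟨_, measurableSet_Ici, rfl⟩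

theorem abs_covariance_le_alphaCoeff_mul_sq {P : Measure Ω} [IsProbabilityMeasure P] {Z W : Ω → ℝ}
    {M : ℝ} (hZ : Measurable Z) (hW : Measurable W) (hZM : ∀ ω, Z ω ∈ Set.Icc 0 M)
    (hWM : ∀ ω, W ω ∈ Set.Icc 0 M) :
    |cov[Z, W; P]| ≤ alphaCoeff P (.comap Z inferInstance) (.comap W inferInstance) * M ^ 2 := by
  have ⟨ω₀⟩ := nonempty_of_isProbabilityMeasure P
  have hM : 0 ≤ M := (hZM ω₀).1.trans (hZM ω₀).2
  have hZL : MemLp Z 2 P := memLp_of_bounded (ae_of_all _ hZM) hZ.aestronglyMeasurable 2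
  have hWL : MemLp W 2 P := memLp_of_bounded (ae_of_all _ hWM) hW.aestronglyMeasurable 2
  have hWint : Integrable W P := hWL.integrable one_le_two
  have hEW : 0 ≤ P[W] := integral_nonneg fun ω => (hWM ω).1
  -- The layer cake comparison, applied once to `W` and once to `Z` under the measure `W dP`.
  have : IsFiniteMeasure (ENNReal.ofReal P[W] • P) := P.smul_finite ENNReal.ofReal_ne_top
  have : IsFiniteMeasure (P.withDensity fun ω => ENNReal.ofReal (W ω)) :=
    isFiniteMeasure_withDensity_ofReal hWint.2
  have := abs_integral_sub_integral_le_of_superlevel (μ := ENNReal.ofReal P[W] • P)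
    (ν := P.withDensity fun ω => ENNReal.ofReal (W ω))
    (a := alphaCoeff P (.comap Z inferInstance) (.comap W inferInstance) * M) hM hZ hZM fun t => ?_
  · rw [integral_smul_measure, integral_withDensity_eq_integral_toReal_smul hW.ennreal_ofReal
      (ae_of_all _ fun ω => ENNReal.ofReal_lt_top), ENNReal.toReal_ofReal hEW] at this
    rw [covariance_comm, covariance_eq_sub hWL hZL, abs_sub_comm, sq, ← mul_assoc]
    simpa only [ENNReal.toReal_ofReal (hWM _).1, smul_eq_mul, Pi.mul_apply] using this
  · have hset : MeasurableSet {ω | t ≤ Z ω} := measurableSet_le measurable_const hZ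
    rw [measureReal_ennreal_smul_apply, ENNReal.toReal_ofReal hEW, mul_comm,
      measureReal_def (P.withDensity _), withDensity_apply _ hset,
      ← ofReal_integral_eq_lintegral_ofReal hWint.restrict (ae_of_all _ fun ω => (hWM ω).1),
      ENNReal.toReal_ofReal (integral_nonneg fun ω => (hWM ω).1)]
    exact abs_measureReal_mul_integral_sub_setIntegral_le hM hW hWM ⟨_, measurableSet_Ici, rfl⟩

theorem covariance_le_of_variance_le {P : Measure Ω} [IsFiniteMeasure P] {Z W : Ω → ℝ} {V : ℝ}
    (hZ : MemLp Z 2 P) (hW : MemLp W 2 P) (hZV : Var[Z; P] ≤ V) (hWV : Var[W; P] ≤ V) :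
    cov[Z, W; P] ≤ V := by
  linarith [variance_sub hZ hW, variance_nonneg (Z - W) P]

theorem variance_sum_le_of_band {P : Measure Ω} [IsFiniteMeasure P] {Z : ℕ → Ω → ℝ} {V c : ℝ}
    {q : ℕ} (hc : 0 ≤ c) (hZ : ∀ i, MemLp (Z i) 2 P) (hV : ∀ i, Var[Z i; P] ≤ V)
    (hcov : ∀ i j, i + q ≤ j → cov[Z i, Z j; P] ≤ c) (k : ℕ) :
    Var[∑ i ∈ Finset.range k, Z i; P] ≤ k * (2 * q * V) + k ^ 2 * c := by
  have hV0 : 0 ≤ V := (variance_nonneg _ _).trans (hV 0)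
  have hentry (i j : ℕ) :
      cov[Z i, Z j; P] ≤ (if j ∈ Finset.Ico (i - q) (i + q) then V else 0) + c := by
    split_ifs with hj
    · linarith [covariance_le_of_variance_le (hZ i) (hZ j) (hV i) (hV j)]
    · rw [zero_add]
      obtain h | h : i + q ≤ j ∨ j + q ≤ i := by rw [Finset.mem_Ico] at hj; omega
      · exact hcov i j h
      · exact (covariance_comm (Z i) (Z j)).trans_le (hcov j i h)
  have hrow (i : ℕ) : ∑ j ∈ Finset.range k, cov[Z i, Z j; P] ≤ 2 * q * V + k * c := by
    have hcard : (Finset.range k ∩ Finset.Ico (i - q) (i + q)).card ≤ 2 * q := by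
      refine (Finset.card_le_card Finset.inter_subset_right).trans ?_
      rw [Nat.card_Ico]
      omega
    refine (Finset.sum_le_sum fun j _ => hentry i j).trans ?_
    rw [Finset.sum_add_distrib, Finset.sum_ite_mem, Finset.sum_const, Finset.sum_const,
      Finset.card_range, nsmul_eq_mul, nsmul_eq_mul]
    gcongr
    exact_mod_cast hcard
  rw [variance_sum' fun i _ => hZ i]
  refine (Finset.sum_le_sum fun i _ => hrow i).trans_eq ?_
  rw [Finset.sum_const, Finset.card_range, nsmul_eq_mul]
  ring

end Covariance

section WeakLaw

variable {Ω : Type*} [MeasurableSpace Ω] {P : Measure Ω}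

theorem truncation_sq_le {α : Type*} {f : α → ℝ} {x : α} (hf : 0 ≤ f x) {M τ : ℝ} (hM : 0 ≤ M)
    (hτ : 0 < τ) (hτ1 : τ ≤ 1) :
    truncation f M x ^ 2 ≤ M ^ (1 - τ) * f x ^ (1 + τ) := by
  by_cases h : f x ∈ Set.Ioc (-M) M
  · have hsplit : f x ^ 2 = f x ^ (1 - τ) * f x ^ (1 + τ) := by
      rw [← Real.rpow_add_of_nonneg hf (by linarith) (by linarith), ← Real.rpow_natCast]
      congr 1
      push_cast
      ring
    rw [truncation, Function.comp_apply, Set.indicator_of_mem h, id_eq, hsplit]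
    gcongr
    exact h.2
  · rw [truncation, Function.comp_apply, Set.indicator_of_notMem h, zero_pow two_ne_zero]
    positivity

theorem sub_truncation_le {α : Type*} {f : α → ℝ} {x : α} (hf : 0 ≤ f x) {M τ : ℝ} (hM : 0 < M)
    (hτ : 0 < τ) : f x - truncation f M x ≤ M ^ (-τ) * f x ^ (1 + τ) := by
  by_cases h : f x ≤ M
  · have hmem : f x ∈ Set.Ioc (-M) M := ⟨by linarith, h⟩
    rw [truncation, Function.comp_apply, Set.indicator_of_mem hmem, id_eq, sub_self]
    positivity
  · rw [truncation, Function.comp_apply, Set.indicator_of_notMem fun h' => h h'.2, sub_zero]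
    have hMf : M < f x := not_le.1 h
    calc f x = f x ^ (-τ) * f x ^ (1 + τ) := by rw [← Real.rpow_add (hM.trans hMf)]; simp
      _ ≤ M ^ (-τ) * f x ^ (1 + τ) := by
        gcongr ?_ * _
        exact Real.rpow_le_rpow_of_nonpos hM hMf.le (by linarith)

theorem integral_sum_of_identDistrib {Y : ℕ → Ω → ℝ} (hY : Integrable (Y 0) P)
    (hid : ∀ i, IdentDistrib (Y i) (Y 0) P P) (k : ℕ) :
    ∫ ω, ∑ i ∈ Finset.range k, Y i ω ∂P = k * P[Y 0] := by
  rw [integral_finsetSum _ fun i _ => (hid i).integrable_iff.2 hY,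
    Finset.sum_congr rfl fun i _ => (hid i).integral_eq, Finset.sum_const, Finset.card_range,
    nsmul_eq_mul]

theorem measureReal_le_sum_le {Y : ℕ → Ω → ℝ} (hY0 : ∀ i ω, 0 ≤ Y i ω) (hY : Integrable (Y 0) P)
    (hid : ∀ i, IdentDistrib (Y i) (Y 0) P P) (k : ℕ) {c : ℝ} (hc : 0 < c) :
    P.real {ω | c ≤ ∑ i ∈ Finset.range k, Y i ω} ≤ k * P[Y 0] / c := by
  rw [le_div_iff₀' hc, ← integral_sum_of_identDistrib hY hid]
  exact mul_meas_ge_le_integral_of_nonneg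
    (ae_of_all _ fun ω => Finset.sum_nonneg fun i _ => hY0 i ω)
    (integrable_finsetSum _ fun i _ => (hid i).integrable_iff.2 hY) c

variable [IsProbabilityMeasure P]

theorem measureReal_le_abs_sum_truncation_sub_le {Y : ℕ → Ω → ℝ} (hY : ∀ i, Measurable (Y i))
    (hY0 : ∀ i ω, 0 ≤ Y i ω) (hid : ∀ i, IdentDistrib (Y i) (Y 0) P P) {q : ℕ} {M a c : ℝ}
    (hM : 0 ≤ M) (hc : 0 < c)
    (hmix : ∀ i j, i + q ≤ j →
      alphaCoeff P (.comap (Y i) inferInstance) (.comap (Y j) inferInstance) ≤ a) (k : ℕ) :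
    P.real {ω | c ≤ |∑ i ∈ Finset.range k, truncation (Y i) M ω - k * P[truncation (Y 0) M]|} ≤
      (k * (2 * q * P[truncation (Y 0) M ^ 2]) + k ^ 2 * (a * M ^ 2)) / c ^ 2 := by
  have ha : 0 ≤ a := alphaCoeff_nonneg.trans (hmix 0 (0 + q) le_rfl)
  have htrunc : Measurable (Set.indicator (Set.Ioc (-M) M) id) :=
    measurable_id.indicator measurableSet_Ioc
  have hZ (i : ℕ) : MemLp (truncation (Y i) M) 2 P := (hY i).aestronglyMeasurable.memLp_truncation
  have hZM (i : ℕ) (ω : Ω) : truncation (Y i) M ω ∈ Set.Icc 0 M :=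
    ⟨truncation_nonneg M (hY0 i ω),
      (le_abs_self _).trans ((abs_truncation_le_bound _ _ _).trans_eq (abs_of_nonneg hM))⟩
  have hidZ (i : ℕ) : IdentDistrib (truncation (Y i) M) (truncation (Y 0) M) P P :=
    (hid i).truncation
  have hcov (i j : ℕ) (hij : i + q ≤ j) :
      cov[truncation (Y i) M, truncation (Y j) M; P] ≤ a * M ^ 2 := by
    refine (le_abs_self _).trans ((abs_covariance_le_alphaCoeff_mul_sq (htrunc.comp (hY i))
      (htrunc.comp (hY j)) (hZM i) (hZM j)).trans ?_)
    gcongr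
    exact (alphaCoeff_mono (htrunc.comp (comap_measurable _)).comap_le
      (htrunc.comp (comap_measurable _)).comap_le).trans (hmix i j hij)
  have hvar := variance_sum_le_of_band (by positivity) hZ (fun i => (hidZ i).variance_eq.trans_le
    (variance_le_expectation_sq (hZ 0).aestronglyMeasurable)) hcov k
  have hmean : ∫ ω, (∑ i ∈ Finset.range k, truncation (Y i) M) ω ∂P =
      k * P[truncation (Y 0) M] := by
    simp only [Finset.sum_apply]
    exact integral_sum_of_identDistrib ((hZ 0).integrable one_le_two) hidZ k
  rw [← hmean]
  refine le_trans ?_ (div_le_div_of_nonneg_right hvar (sq_nonneg c))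
  refine ENNReal.toReal_le_of_le_ofReal (div_nonneg (variance_nonneg _ _) (sq_nonneg c)) ?_
  simpa only [Finset.sum_apply] using
    meas_ge_le_variance_div_sq (memLp_finsetSum' _ fun i _ => hZ i) hc

theorem measureReal_abs_sum_sub_gt_le {Y : ℕ → Ω → ℝ} (hY : ∀ i, Measurable (Y i))
    (hY0 : ∀ i ω, 0 ≤ Y i ω) (hid : ∀ i, IdentDistrib (Y i) (Y 0) P P)
    (hint : Integrable (Y 0) P) {q : ℕ} {M a c : ℝ} (hM : 0 ≤ M) (hc : 0 < c)
    (hmix : ∀ i j, i + q ≤ j →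
      alphaCoeff P (.comap (Y i) inferInstance) (.comap (Y j) inferInstance) ≤ a) (k : ℕ) :
    P.real {ω | 3 * c < |∑ i ∈ Finset.range k, Y i ω - k * P[Y 0]|} ≤
      (k * (2 * q * P[truncation (Y 0) M ^ 2]) + k ^ 2 * (a * M ^ 2)) / c ^ 2 +
        k * P[Y 0 - truncation (Y 0) M] / c := by
  have ha : 0 ≤ a := alphaCoeff_nonneg.trans (hmix 0 (0 + q) le_rfl)
  have htail0 (i : ℕ) (ω : Ω) : 0 ≤ (Y i - truncation (Y i) M) ω :=
    sub_nonneg.2 ((le_abs_self _).trans ((abs_truncation_le_abs_self _ _ _).trans_eq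
      (abs_of_nonneg (hY0 i ω))))
  have hidtail (i : ℕ) : IdentDistrib (Y i - truncation (Y i) M) (Y 0 - truncation (Y 0) M) P P :=
    (hid i).comp (measurable_id.sub (measurable_id.indicator measurableSet_Ioc))
  have htrint : Integrable (truncation (Y 0) M) P :=
    (hY 0).aestronglyMeasurable.integrable_truncation
  have htailE : P[Y 0 - truncation (Y 0) M] = P[Y 0] - P[truncation (Y 0) M] :=
    integral_sub' hint htrint
  have htailE0 : 0 ≤ P[Y 0 - truncation (Y 0) M] := integral_nonneg (htail0 0)
  obtain hbig | hsmall := lt_or_ge c (k * P[Y 0 - truncation (Y 0) M])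
  · refine measureReal_le_one.trans (((one_le_div hc).2 hbig.le).trans (le_add_of_nonneg_left ?_))
    have : 0 ≤ P[truncation (Y 0) M ^ 2] := integral_nonneg fun ω => sq_nonneg _
    positivity
  refine (measureReal_mono fun ω hω => ?_).trans ((measureReal_union_le _ _).trans (add_le_add
    (measureReal_le_abs_sum_truncation_sub_le hY hY0 hid hM hc hmix k)
    (measureReal_le_sum_le htail0 (hint.sub htrint) hidtail k hc)))
  by_contra hcon
  simp only [Set.mem_union, Set.mem_ofPred_eq, not_or, not_le, Pi.sub_apply,
    Finset.sum_sub_distrib] at hcon hω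
  have htail := Finset.sum_nonneg fun i (_ : i ∈ Finset.range k) => htail0 i ω
  simp only [Pi.sub_apply, Finset.sum_sub_distrib] at htail
  rw [htailE] at hsmall htailE0
  obtain ⟨hlow, hhigh⟩ := abs_lt.1 hcon.1
  rw [lt_abs] at hω
  have hkE : 0 ≤ (k : ℝ) * _ := mul_nonneg k.cast_nonneg htailE0
  rcases hω with hω | hω <;> linarith [hcon.2]

-- The variables are truncated at the level `M = k * (ε * P[Y 0]) / q`.
theorem measureReal_abs_average_sub_gt_le {Y : ℕ → Ω → ℝ} (hY : ∀ i, Measurable (Y i))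
    (hY0 : ∀ i ω, 0 ≤ Y i ω) (hid : ∀ i, IdentDistrib (Y i) (Y 0) P P)
    (hint : Integrable (Y 0) P) (hpos : 0 < P[Y 0]) {τ : ℝ} (hτ : 0 < τ) (hτ1 : τ ≤ 1)
    (hp : Integrable (fun ω => Y 0 ω ^ (1 + τ)) P) {k q : ℕ} (hk : 0 < k) (hq : 0 < q)
    {ε a : ℝ} (hε : 0 < ε)
    (hmix : ∀ i j, i + q ≤ j →
      alphaCoeff P (.comap (Y i) inferInstance) (.comap (Y j) inferInstance) ≤ a) :
    P.real {ω | ε * P[Y 0] < |(k : ℝ)⁻¹ * ∑ i ∈ Finset.range k, Y i ω - P[Y 0]|} ≤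
      21 * ((q / k : ℝ) ^ τ * ε ^ (-(1 + τ)) *
        ((∫ ω, Y 0 ω ^ (1 + τ) ∂P) / P[Y 0] ^ (1 + τ))) + 9 * (a * k ^ 2 / q ^ 2) := by
  set e := P[Y 0]
  set mp := ∫ ω, Y 0 ω ^ (1 + τ) ∂P
  set R := (q / k : ℝ) ^ τ * ε ^ (-(1 + τ)) * (mp / e ^ (1 + τ)) with hR
  set M : ℝ := k * (ε * e) / q with hM
  set c : ℝ := k * (ε * e) / 3 with hc
  have hM0 : 0 < M := by positivity
  have hRM : M ^ (-τ) * mp = R * (ε * e) := by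
    have hinv : M = (q / k : ℝ)⁻¹ * (ε * e) := by rw [hM]; field_simp
    rw [hR, hinv, Real.mul_rpow (by positivity) (by positivity),
      Real.rpow_neg_eq_inv_rpow (q / k : ℝ)⁻¹, inv_inv, Real.mul_rpow hε.le hpos.le,
      Real.rpow_neg hε.le (1 + τ), Real.rpow_add hε, Real.rpow_add hpos, Real.rpow_one,
      Real.rpow_one, Real.rpow_neg hε.le, Real.rpow_neg hpos.le]
    field_simp
  have hsq : P[truncation (Y 0) M ^ 2] ≤ M * (R * (ε * e)) := by
    refine (integral_mono_of_nonneg (ae_of_all _ fun ω => sq_nonneg _) (hp.const_mul _)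
      (ae_of_all _ fun ω => truncation_sq_le (hY0 0 ω) hM0.le hτ hτ1)).trans_eq ?_
    rw [integral_const_mul, ← hRM, sub_eq_add_neg, Real.rpow_add hM0, Real.rpow_one, mul_assoc]
  have htail : P[Y 0 - truncation (Y 0) M] ≤ R * (ε * e) := by
    rw [← hRM, ← integral_const_mul]
    exact integral_mono (hint.sub (hY 0).aestronglyMeasurable.integrable_truncation)
      (hp.const_mul _) fun ω => sub_truncation_le (hY0 0 ω) hM0 hτ
  calc P.real {ω | ε * e < |(k : ℝ)⁻¹ * ∑ i ∈ Finset.range k, Y i ω - e|}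
      = P.real {ω | 3 * c < |∑ i ∈ Finset.range k, Y i ω - k * e|} := by
        congr 1
        ext ω
        have hscale : (k : ℝ)⁻¹ * ∑ i ∈ Finset.range k, Y i ω - e =
            (k : ℝ)⁻¹ * (∑ i ∈ Finset.range k, Y i ω - k * e) := by field_simp
        rw [Set.mem_ofPred_eq, Set.mem_ofPred_eq, hscale, abs_mul, abs_of_pos (by positivity),
          lt_inv_mul_iff₀ (by positivity), hc, mul_div_cancel₀ _ three_ne_zero]
    _ ≤ (k * (2 * q * P[truncation (Y 0) M ^ 2]) + k ^ 2 * (a * M ^ 2)) / c ^ 2 +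
        k * P[Y 0 - truncation (Y 0) M] / c :=
      measureReal_abs_sum_sub_gt_le hY hY0 hid hint hM0.le (by positivity) hmix k
    _ ≤ (k * (2 * q * (M * (R * (ε * e)))) + k ^ 2 * (a * M ^ 2)) / c ^ 2 +
        k * (R * (ε * e)) / c := by gcongr
    _ = 21 * R + 9 * (a * k ^ 2 / q ^ 2) := by
      rw [hc, hM]
      field_simp
      ring

end WeakLaw

section LaplaceTransform

variable {α F : Type*} {mα : MeasurableSpace α} {μ : Measure α} {u v : α → ℝ} {a b c : ℝ}

theorem integrable_exp_convex_combination (hu : Integrable (fun x => Real.exp (u x)) μ)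
    (hv : Integrable (fun x => Real.exp (v x)) μ) (ha : 0 ≤ a) (hb : 0 ≤ b) (hab : a + b = 1) :
    Integrable (fun x => Real.exp (a * u x + b * v x)) μ := by
  have hum := Real.aemeasurable_of_aemeasurable_exp hu.aemeasurable
  have hvm := Real.aemeasurable_of_aemeasurable_exp hv.aemeasurable
  refine ((hu.const_mul a).add (hv.const_mul b)).mono'
    ((hum.const_mul a).add (hvm.const_mul b)).exp.aestronglyMeasurable (ae_of_all _ fun x => ?_)
  rw [Real.norm_eq_abs, Real.abs_exp]
  exact convexOn_exp.2 (Set.mem_univ _) (Set.mem_univ _) ha hb hab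

theorem integral_exp_convex_combination_le (hu : Integrable (fun x => Real.exp (u x)) μ)
    (hv : Integrable (fun x => Real.exp (v x)) μ) (ha : 0 ≤ a) (hb : 0 ≤ b) (hab : a + b = 1) :
    ∫ x, Real.exp (a * u x + b * v x) ∂μ ≤
      (∫ x, Real.exp (u x) ∂μ) ^ a * (∫ x, Real.exp (v x) ∂μ) ^ b := by
  have h := ENNReal.lintegral_mul_norm_pow_le hu.aemeasurable.ennreal_ofReal
    hv.aemeasurable.ennreal_ofReal ha hb hab
  have hmul : ∀ x, ENNReal.ofReal (Real.exp (u x)) ^ a * ENNReal.ofReal (Real.exp (v x)) ^ b =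
      ENNReal.ofReal (Real.exp (a * u x + b * v x)) := fun x => by
    rw [ENNReal.ofReal_rpow_of_pos (Real.exp_pos _), ENNReal.ofReal_rpow_of_pos (Real.exp_pos _),
      ← ENNReal.ofReal_mul (by positivity), ← Real.exp_mul, ← Real.exp_mul, ← Real.exp_add,
      mul_comm a, mul_comm b]
  have hlint : ∀ {w : α → ℝ}, Integrable (fun x => Real.exp (w x)) μ →
      ∫⁻ x, ENNReal.ofReal (Real.exp (w x)) ∂μ = ENNReal.ofReal (∫ x, Real.exp (w x) ∂μ) :=
    fun hw => (ofReal_integral_eq_lintegral_ofReal hw (ae_of_all _ fun _ => by positivity)).symm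
  have hexp : ∀ w : α → ℝ, 0 ≤ ∫ x, Real.exp (w x) ∂μ := fun w =>
    integral_nonneg fun _ => (Real.exp_pos _).le
  simp only [hmul] at h
  rw [hlint hu, hlint hv, hlint (integrable_exp_convex_combination hu hv ha hb hab),
    ENNReal.ofReal_rpow_of_nonneg (hexp u) ha, ENNReal.ofReal_rpow_of_nonneg (hexp v) hb,
    ← ENNReal.ofReal_mul (Real.rpow_nonneg (hexp u) a)] at h
  exact (ENNReal.ofReal_le_ofReal_iff
    (mul_nonneg (Real.rpow_nonneg (hexp u) a) (Real.rpow_nonneg (hexp v) b))).1 h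

theorem integrable_exp_of_abs_sub_le (hvm : AEMeasurable v μ) (huv : ∀ x, |u x - v x| ≤ c)
    (hu : Integrable (fun x => Real.exp (u x)) μ) : Integrable (fun x => Real.exp (v x)) μ := by
  refine (hu.const_mul (Real.exp c)).mono' hvm.exp.aestronglyMeasurable (ae_of_all _ fun x => ?_)
  rw [Real.norm_eq_abs, Real.abs_exp, ← Real.exp_add]
  gcongr
  linarith [(abs_le.1 (huv x)).1]

theorem abs_log_integral_exp_sub_le [NeZero μ] (huv : ∀ x, |u x - v x| ≤ c)
    (hu : Integrable (fun x => Real.exp (u x)) μ) (hv : Integrable (fun x => Real.exp (v x)) μ) :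
    |Real.log (∫ x, Real.exp (u x) ∂μ) - Real.log (∫ x, Real.exp (v x) ∂μ)| ≤ c := by
  have one_side : ∀ {u v : α → ℝ}, (∀ x, |u x - v x| ≤ c) →
      Integrable (fun x => Real.exp (u x)) μ → Integrable (fun x => Real.exp (v x)) μ →
      Real.log (∫ x, Real.exp (u x) ∂μ) - Real.log (∫ x, Real.exp (v x) ∂μ) ≤ c := by
    intro u v huv hu hv
    rw [← Real.log_div (integral_exp_pos hu).ne' (integral_exp_pos hv).ne',
      Real.log_le_iff_le_exp (div_pos (integral_exp_pos hu) (integral_exp_pos hv)),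
      div_le_iff₀ (integral_exp_pos hv), ← integral_const_mul]
    refine integral_mono hu (hv.const_mul _) fun x => ?_
    simp only [← Real.exp_add]
    gcongr
    linarith [(abs_le.1 (huv x)).2]
  have hvu := one_side (fun x => (abs_sub_comm _ _).trans_le (huv x)) hv hu
  exact abs_le.2 ⟨by linarith, one_side huv hu hv⟩

variable [NormedAddCommGroup F] [InnerProductSpace ℝ F]

theorem convex_setOf_integrable_exp_inner (μ : Measure α) (V : α → F) :
    Convex ℝ {l : F | Integrable (fun x => Real.exp (inner ℝ l (V x))) μ} := by
  intro x hx y hy a b ha hb hab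
  simpa only [Set.mem_ofPred_eq, inner_add_left, real_inner_smul_left] using
    integrable_exp_convex_combination hx hy ha hb hab

theorem convexOn_log_integral_exp_inner [NeZero μ] {V : α → F} {s : Set F} (hs : Convex ℝ s)
    (hint : ∀ l ∈ s, Integrable (fun x => Real.exp (inner ℝ l (V x))) μ) :
    ConvexOn ℝ s fun l => Real.log (∫ x, Real.exp (inner ℝ l (V x)) ∂μ) := by
  refine ⟨hs, fun x hx y hy a b ha hb hab => ?_⟩
  have hpos : ∀ l ∈ s, 0 < ∫ x, Real.exp (inner ℝ l (V x)) ∂μ := fun l hl =>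
    integral_exp_pos (hint l hl)
  have holder := integral_exp_convex_combination_le (hint x hx) (hint y hy) ha hb hab
  simp only [← real_inner_smul_left, ← inner_add_left] at holder
  have hlog := Real.log_le_log (hpos _ (hs hx hy ha hb hab)) holder
  rwa [Real.log_mul (Real.rpow_pos_of_pos (hpos x hx) _).ne'
    (Real.rpow_pos_of_pos (hpos y hy) _).ne', Real.log_rpow (hpos x hx),
    Real.log_rpow (hpos y hy)] at hlog

end LaplaceTransform

section Calculus

theorem le_taylor_of_deriv_deriv_le {g g' g'' : ℝ → ℝ} {τ c : ℝ} (hτ : 0 ≤ τ)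
    (hg : ∀ t ∈ Set.Icc 0 τ, HasDerivAt g (g' t) t)
    (hg' : ∀ t ∈ Set.Icc 0 τ, HasDerivAt g' (g'' t) t) (hc : ∀ t ∈ Set.Icc 0 τ, g'' t ≤ 2 * c) :
    g τ ≤ g 0 + τ * g' 0 + τ ^ 2 * c := by
  have hIco : ∀ {t}, t ∈ Set.Ico 0 τ → t ∈ Set.Icc 0 τ := fun ht => Set.Ico_subset_Icc_self ht
  have deriv_le : ∀ t ∈ Set.Icc 0 τ, g' t ≤ g' 0 + 2 * c * t := by
    refine image_le_of_deriv_right_le_deriv_boundary (f' := g'') (B' := fun _ => 2 * c)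
      (fun t ht => (hg' t ht).continuousAt.continuousWithinAt)
      (fun t ht => (hg' t (hIco ht)).hasDerivWithinAt) (by simp) (by fun_prop) (fun t _ => ?_)
      fun t ht => hc t (hIco ht)
    simpa using (((hasDerivAt_id t).const_mul (2 * c)).const_add (g' 0)).hasDerivWithinAt
  refine image_le_of_deriv_right_le_deriv_boundary (f' := g') (a := 0)
    (B := fun t => g 0 + t * g' 0 + t ^ 2 * c) (B' := fun t => g' 0 + 2 * c * t)
    (fun t ht => (hg t ht).continuousAt.continuousWithinAt)
    (fun t ht => (hg t (hIco ht)).hasDerivWithinAt) (by simp) (by fun_prop) (fun t _ => ?_)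
    (fun t ht => deriv_le t (hIco ht)) ⟨hτ, le_rfl⟩
  have hB := (((hasDerivAt_id t).mul_const (g' 0)).const_add (g 0)).add
    (((hasDerivAt_id t).pow 2).mul_const c)
  exact (hB.congr_deriv (by simp; ring)).hasDerivWithinAt

variable {F : Type*} [NormedAddCommGroup F] [NormedSpace ℝ F] {f : F → ℝ} {D : Set F} {l v : F}

theorem hasDerivAt_line (l v : F) (t : ℝ) : HasDerivAt (fun t : ℝ => l + t • v) v t := by
  simpa using ((hasDerivAt_id t).smul_const v).const_add l

theorem hasDerivAt_comp_line (hD : IsOpen D) (hf : ContDiffOn ℝ 2 f D) {t : ℝ}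
    (ht : l + t • v ∈ D) :
    HasDerivAt (fun t : ℝ => f (l + t • v)) (fderiv ℝ f (l + t • v) v) t :=
  ((hf.contDiffAt (hD.mem_nhds ht)).differentiableAt two_ne_zero).hasFDerivAt.comp_hasDerivAt t
    (hasDerivAt_line l v t)

theorem hasDerivAt_fderiv_comp_line (hD : IsOpen D) (hf : ContDiffOn ℝ 2 f D) {t : ℝ}
    (ht : l + t • v ∈ D) :
    HasDerivAt (fun t : ℝ => fderiv ℝ f (l + t • v) v)
      (fderiv ℝ (fderiv ℝ f) (l + t • v) v v) t := by
  have hdiff : DifferentiableAt ℝ (fderiv ℝ f) (l + t • v) :=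
    ((hf.contDiffAt (hD.mem_nhds ht)).fderiv_right (m := 1) (by norm_num)).differentiableAt
      one_ne_zero
  have hcomp := hdiff.hasFDerivAt.comp_hasDerivAt t (hasDerivAt_line l v t)
  simpa using hcomp.clm_apply (hasDerivAt_const t v)

-- The bound on the Hessian is the one defining `xi2`: at each point `p`, in the direction `p`.
theorem le_taylor_radial (hD : IsOpen D) (hf : ContDiffOn ℝ 2 f D) {τ x : ℝ} (hτ : 0 ≤ τ)
    (hx : 0 ≤ x) (hseg : ∀ t ∈ Set.Icc 0 τ, l + t • l ∈ D)
    (hess : ∀ t ∈ Set.Icc 0 τ,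
      1 / 2 * fderiv ℝ (fderiv ℝ f) (l + t • l) (l + t • l) (l + t • l) ≤ x) :
    f (l + τ • l) ≤ f l + τ * fderiv ℝ f l l + τ ^ 2 * x := by
  have htaylor := le_taylor_of_deriv_deriv_le (c := x) hτ
    (fun t ht => hasDerivAt_comp_line hD hf (hseg t ht))
    (fun t ht => hasDerivAt_fderiv_comp_line hD hf (hseg t ht)) fun t ht => ?_
  · simpa using htaylor
  have hquad : fderiv ℝ (fderiv ℝ f) (l + t • l) (l + t • l) (l + t • l) =
      (1 + t) ^ 2 * fderiv ℝ (fderiv ℝ f) (l + t • l) l l := by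
    have hl : (1 + t) • l = l + t • l := by rw [add_smul, one_smul]
    generalize fderiv ℝ (fderiv ℝ f) (l + t • l) = H
    rw [← hl, map_smul, map_smul, smul_apply, smul_eq_mul, smul_eq_mul]
    ring
  have hle := hess t ht
  rw [hquad] at hle
  rcases le_total (fderiv ℝ (fderiv ℝ f) (l + t • l) l l) 0 with h0 | h0
  · exact h0.trans (by positivity)
  · nlinarith [mul_le_mul_of_nonneg_right (show 1 ≤ (1 + t) ^ 2 by nlinarith [ht.1]) h0]

theorem fderiv_fderiv_nonneg_of_convexOn (hD : IsOpen D) (hf : ContDiffOn ℝ 2 f D)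
    (hconv : ConvexOn ℝ D f) (hl : l ∈ D) (v : F) : 0 ≤ fderiv ℝ (fderiv ℝ f) l v v := by
  set I : Set ℝ := {t | l + t • v ∈ D}
  have hI : IsOpen I := hD.preimage (by fun_prop : Continuous fun t : ℝ => l + t • v)
  have h0 : (0 : ℝ) ∈ I := by simpa [I] using hl
  have hline : ConvexOn ℝ I fun t : ℝ => f (l + t • v) := by
    convert hconv.comp_affineMap (AffineMap.lineMap l (l + v) : ℝ →ᵃ[ℝ] F) using 1 <;>
      ext t <;> simp [I, AffineMap.lineMap_apply, add_comm]
  have hmono : MonotoneOn (fun t : ℝ => fderiv ℝ f (l + t • v) v) I :=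
    (hline.monotoneOn_deriv fun t ht => (hasDerivAt_comp_line hD hf ht).differentiableAt).congr
      fun t ht => (hasDerivAt_comp_line hD hf ht).deriv
  have hnonneg := hmono.derivWithin_nonneg (x := 0)
  rw [derivWithin_of_isOpen hI h0, (hasDerivAt_fderiv_comp_line hD hf h0).deriv] at hnonneg
  simpa using hnonneg

theorem lipschitzOnWith_ball_of_convexOn {x₀ : F} {r M m : ℝ} (hr : 0 < r)
    (hf : ConvexOn ℝ (Metric.ball x₀ r) f) (hM : ∀ x ∈ Metric.ball x₀ r, f x ≤ M)
    (hm : m ≤ f x₀) :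
    LipschitzOnWith (2 * (|M| + 2 * |m|) / (r / 2)).toNNReal f (Metric.ball x₀ (r / 2)) := by
  have habs : ∀ x, dist x x₀ < r → |f x| ≤ |M| + 2 * |m| := fun x hx => by
    have hreflect : (2 : ℝ) • x₀ - x ∈ Metric.ball x₀ r := by
      rwa [Metric.mem_ball, dist_eq_norm, two_smul, show x₀ + x₀ - x - x₀ = -(x - x₀) by abel,
        norm_neg, ← dist_eq_norm]
    have hmid := hf.2 (Metric.mem_ball.2 hx) hreflect one_half_pos.le one_half_pos.le
      (add_halves 1)
    rw [show (1 / 2 : ℝ) • x + (1 / 2 : ℝ) • ((2 : ℝ) • x₀ - x) = x₀ by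
      rw [smul_sub, smul_smul]; norm_num, smul_eq_mul, smul_eq_mul] at hmid
    rw [abs_le]
    constructor <;> linarith [le_abs_self M, neg_abs_le m, abs_nonneg m, hM _ hreflect,
      hM x (Metric.mem_ball.2 hx)]
  simpa only [sub_half] using hf.lipschitzOnWith_of_abs_le (half_pos hr) habs

end Calculus

section Net

open Module Metric

variable {F : Type*} [NormedAddCommGroup F] [NormedSpace ℝ F] [FiniteDimensional ℝ F]

theorem card_le_of_pairwise_lt_dist {s : Finset F} {R r : ℝ} (hR : 0 ≤ R) (hr : 0 < r)
    (hs : (s : Set F) ⊆ closedBall 0 R) (hsep : (s : Set F).Pairwise (r < dist · ·)) :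
    (s.card : ℝ) ≤ (1 + 2 * R / r) ^ finrank ℝ F := by
  borelize F
  let ν : Measure F := Measure.addHaar
  have hdisj : (s : Set F).PairwiseDisjoint fun c => ball c (r / 2) := fun c hc c' hc' hne =>
    ball_disjoint_ball (by rw [add_halves]; exact (hsep hc hc' hne).le)
  have hsub : ⋃ c ∈ s, ball c (r / 2) ⊆ ball (0 : F) (R + r / 2) :=
    Set.iUnion₂_subset fun c hc => ball_subset_ball' (by linarith [mem_closedBall.1 (hs hc)])
  have hvol := measure_mono (μ := ν) hsub
  rw [measure_biUnion_finset hdisj fun _ _ => measurableSet_ball,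
    ν.addHaar_ball_of_pos _ (by positivity)] at hvol
  simp only [ν.addHaar_ball_of_pos _ (half_pos hr), Finset.sum_const, nsmul_eq_mul,
    ← mul_assoc] at hvol
  have hcard : s.card * (r / 2) ^ finrank ℝ F ≤ (R + r / 2) ^ finrank ℝ F := by
    have := ENNReal.toReal_le_of_le_ofReal (by positivity)
      ((ENNReal.mul_le_mul_iff_left (measure_ball_pos ν _ one_pos).ne' measure_ball_lt_top.ne).1
        hvol)
    rwa [ENNReal.toReal_mul, ENNReal.toReal_natCast, ENNReal.toReal_ofReal (by positivity)] at this
  rw [← le_div_iff₀ (by positivity), ← div_pow] at hcard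
  exact hcard.trans_eq (by congr 1; field_simp; ring)

theorem packingNumber_le_of_subset_closedBall {B : Set F} {R : ℝ} {r : NNReal} (hR : 0 ≤ R)
    (hr : 0 < r) (hB : B ⊆ closedBall 0 R) :
    packingNumber r B ≤ ⌊(1 + 2 * R / r) ^ finrank ℝ F⌋₊ := by
  refine iSup₂_le fun C hCB => iSup_le fun hC => ?_
  by_contra! hlt
  obtain ⟨t, htC, ht⟩ := Set.exists_subset_encard_eq (Order.add_one_le_of_lt hlt)
  have hfin : t.Finite := Set.finite_of_encard_eq_coe (by exact_mod_cast ht)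
  have hsep : (hfin.toFinset : Set F).Pairwise (r < dist · ·) := fun x hx y hy hne => by
    have hlt : (r : ℝ≥0∞) < edist x y :=
      hC (htC (hfin.mem_toFinset.1 hx)) (htC (hfin.mem_toFinset.1 hy)) hne
    rwa [edist_nndist, ENNReal.coe_lt_coe, ← NNReal.coe_lt_coe, coe_nndist] at hlt
  have hcard := card_le_of_pairwise_lt_dist hR hr (by simpa using htC.trans (hCB.trans hB)) hsep
  rw [← Nat.le_floor_iff (by have := r.coe_nonneg; positivity)] at hcard
  rw [hfin.encard_eq_coe_toFinset_card] at ht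
  have hcard_eq : hfin.toFinset.card = ⌊(1 + 2 * R / r) ^ finrank ℝ F⌋₊ + 1 := by
    exact_mod_cast ht
  exact absurd hcard (by rw [hcard_eq]; exact Nat.not_succ_le_self _)

theorem exists_finset_net {B : Set F} (hB : Bornology.IsBounded B) :
    ∃ C : ℝ, 0 < C ∧ ∀ r : ℝ, 0 < r → r ≤ 1 → ∃ N : Finset F, (N : Set F) ⊆ B ∧
      (N.card : ℝ) ≤ C * r ^ (-(finrank ℝ F : ℝ)) ∧ ∀ x ∈ B, ∃ y ∈ N, dist x y ≤ r := by
  obtain ⟨R, hR, hBR⟩ := hB.exists_pos_norm_le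
  refine ⟨(1 + 2 * R) ^ finrank ℝ F, by positivity, fun r hr hr1 => ?_⟩
  lift r to NNReal using hr.le
  have hpack := packingNumber_le_of_subset_closedBall hR.le hr fun x hx =>
    mem_closedBall_zero_iff.2 (hBR x hx)
  have hne : packingNumber r B ≠ ⊤ := ne_top_of_le_ne_top (ENat.natCast_ne_top _) hpack
  have hcard := (encard_maximalSeparatedSet hne).trans_le hpack
  have hfin := Set.finite_of_encard_le_coe hcard
  refine ⟨hfin.toFinset, by simpa using maximalSeparatedSet_subset, ?_, fun x hx => ?_⟩
  · rw [hfin.encard_eq_coe_toFinset_card, Nat.cast_le] at hcard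
    calc (hfin.toFinset.card : ℝ)
        ≤ (1 + 2 * R / r) ^ finrank ℝ F := (Nat.le_floor_iff (by positivity)).1 hcard
      _ ≤ ((1 + 2 * R) / r) ^ finrank ℝ F := by
          rw [add_div]
          gcongr
          exact (one_le_div hr).2 hr1
      _ = (1 + 2 * R) ^ finrank ℝ F * r ^ (-(finrank ℝ F : ℝ)) := by
          rw [div_pow, Real.rpow_neg r.coe_nonneg, Real.rpow_natCast, div_eq_mul_inv]
  · obtain ⟨y, hy, hxy⟩ := isCover_maximalSeparatedSet hne hx
    refine ⟨y, hfin.mem_toFinset.2 hy, ?_⟩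
    change edist x y ≤ r at hxy
    rwa [edist_nndist, ENNReal.coe_le_coe, ← NNReal.coe_le_coe, coe_nndist] at hxy

end Net

section MixingGap

/-- The number of consecutive blocks of length `n` after which the mixing rate `exp (-γ m ^ θ)` is
at most `exp (-4 * L) * n ^ (-2)`; it is used with `L = log (k n)`. -/
noncomputable def mixingGap (γ θ L : ℝ) (n : ℕ) : ℕ :=
  ⌈((4 * L + 2 * Real.log n) / γ) ^ (1 / θ) / n⌉₊ + 2

variable {γ θ L : ℝ} {n : ℕ}

theorem mixingGap_pos : (0 : ℝ) < mixingGap γ θ L n := by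
  exact_mod_cast Nat.succ_pos _

theorem three_le_mixingGap (hγ : 0 < γ) (hL : 0 ≤ L) (hn : 2 ≤ n) : 3 ≤ mixingGap γ θ L n := by
  have hlog : 0 < Real.log n := Real.log_pos (by exact_mod_cast hn)
  have hceil : 0 < ⌈((4 * L + 2 * Real.log n) / γ) ^ (1 / θ) / n⌉₊ := Nat.ceil_pos.2 (by positivity)
  rw [mixingGap]
  omega

theorem four_mul_add_le_mixingGap (hγ : 0 < γ) (hθ : 0 < θ) (hL : 0 ≤ L) (hn : 1 ≤ n) :
    4 * L + 2 * Real.log n ≤ γ * (((mixingGap γ θ L n - 2) * n + 1 : ℕ) : ℝ) ^ θ := by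
  have hn0 : (0 : ℝ) < n := by exact_mod_cast hn
  set b := (4 * L + 2 * Real.log n) / γ with hb
  have hb0 : 0 ≤ b := by positivity
  have hgap : b ^ (1 / θ) ≤ (((mixingGap γ θ L n - 2) * n + 1 : ℕ) : ℝ) := by
    rw [mixingGap, Nat.add_sub_cancel, ← hb, ← div_mul_cancel₀ (b ^ (1 / θ)) hn0.ne']
    push_cast
    have hceil := Nat.le_ceil (b ^ (1 / θ) / n)
    rw [div_mul_cancel₀ _ hn0.ne']
    nlinarith [div_mul_cancel₀ (b ^ (1 / θ)) hn0.ne']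
  calc 4 * L + 2 * Real.log n = γ * (b ^ (1 / θ)) ^ θ := by
        rw [← Real.rpow_mul hb0, one_div_mul_cancel hθ.ne', Real.rpow_one, hb]
        field_simp
    _ ≤ _ := by gcongr

theorem mixingGap_le (hγ : 0 < γ) (hL : 0 ≤ L) :
    (mixingGap γ θ L n : ℝ) ≤ ((4 * L + 2 * Real.log n) / γ) ^ (1 / θ) / n + 3 := by
  have := Nat.ceil_lt_add_one
    (show 0 ≤ ((4 * L + 2 * Real.log n) / γ) ^ (1 / θ) / n by positivity)
  rw [mixingGap]
  push_cast
  linarith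

theorem log_mixingGap_le_two (hγ : 0 < γ) (hθ : 0 < θ) (hL : 0 ≤ L) (hn : 1 ≤ n)
    (h : (4 * L + 2 * Real.log n) / γ ≤ (n : ℝ) ^ θ) : Real.log (mixingGap γ θ L n) ≤ 2 := by
  have hn0 : (0 : ℝ) < n := by exact_mod_cast hn
  have hle : ((4 * L + 2 * Real.log n) / γ) ^ (1 / θ) / n ≤ 1 := by
    rw [div_le_one hn0]
    calc _ ≤ ((n : ℝ) ^ θ) ^ (1 / θ) := by gcongr
      _ = n := by rw [← Real.rpow_mul hn0.le, mul_one_div_cancel hθ.ne', Real.rpow_one]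
  rw [Real.log_le_iff_le_exp mixingGap_pos]
  linarith [mixingGap_le (θ := θ) (n := n) hγ hL, Real.quadratic_le_exp_of_nonneg zero_le_two]

theorem log_mixingGap_le_mul_log (hγ : 0 < γ) (hθ : 0 < θ) (hn : 1 ≤ n) (hlogn : Real.log n ≤ L)
    (hL : (6 / γ) ^ (1 / θ) + 3 ≤ L) :
    Real.log (mixingGap γ θ L n) ≤ (1 / θ + 1) * Real.log L := by
  have hn1 : (1 : ℝ) ≤ n := by exact_mod_cast hn
  have hc : 0 ≤ (6 / γ) ^ (1 / θ) := by positivity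
  have hL1 : 1 ≤ L := by linarith
  have hLθ : 1 ≤ L ^ (1 / θ) := Real.one_le_rpow hL1 (by positivity)
  have hle : (mixingGap γ θ L n : ℝ) ≤ L ^ (1 / θ + 1) :=
    calc (mixingGap γ θ L n : ℝ)
        ≤ ((4 * L + 2 * Real.log n) / γ) ^ (1 / θ) / n + 3 := mixingGap_le hγ (by linarith)
      _ ≤ ((4 * L + 2 * Real.log n) / γ) ^ (1 / θ) + 3 := by
          gcongr
          exact div_le_self (by positivity) hn1
      _ ≤ (6 / γ * L) ^ (1 / θ) + 3 := by
          gcongr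
          rw [div_mul_eq_mul_div]
          gcongr
          linarith
      _ = (6 / γ) ^ (1 / θ) * L ^ (1 / θ) + 3 := by
          rw [Real.mul_rpow (by positivity) (by linarith)]
      _ ≤ ((6 / γ) ^ (1 / θ) + 3) * L ^ (1 / θ) := by linarith
      _ ≤ L * L ^ (1 / θ) := by gcongr
      _ = L ^ (1 / θ + 1) := by rw [Real.rpow_add (by linarith), Real.rpow_one, mul_comm]
  rw [← Real.log_rpow (by linarith)]
  exact Real.log_le_log mixingGap_pos hle

theorem tendsto_natCast_rpow_atTop {c : ℝ} (hc : 0 < c) :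
    Tendsto (fun n : ℕ => (n : ℝ) ^ c) atTop atTop :=
  (tendsto_rpow_atTop hc).comp tendsto_natCast_atTop_atTop

theorem eventually_log_natCast_le_mul_rpow {b c : ℝ} (hb : 0 < b) (hc : 0 < c) :
    ∀ᶠ n : ℕ in atTop, Real.log n ≤ b * (n : ℝ) ^ c := by
  filter_upwards [tendsto_natCast_atTop_atTop.eventually
    ((isLittleO_log_rpow_atTop hc).bound hb)] with n hn
  rw [Real.norm_of_nonneg (Real.rpow_nonneg n.cast_nonneg c)] at hn
  exact (le_abs_self _).trans hn

theorem eventually_log_mixingGap_le (hγ : 0 < γ) (hθ : 0 < θ) :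
    ∀ᶠ n : ℕ in atTop, ∀ L : ℝ, 0 ≤ L → Real.log (mixingGap γ θ L n) ≤ 2 ∨
      ((n : ℝ) ^ (θ / 2) ≤ L ∧ Real.log (mixingGap γ θ L n) ≤ (1 / θ + 1) * Real.log L) := by
  have hpow := tendsto_natCast_rpow_atTop (half_pos hθ)
  filter_upwards [eventually_log_natCast_le_mul_rpow one_pos (half_pos hθ), eventually_ge_atTop 1,
    hpow.eventually_ge_atTop (6 / γ), hpow.eventually_ge_atTop ((6 / γ) ^ (1 / θ) + 3)]
    with n hlog hn hlarge hlarge' L hL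
  rw [one_mul] at hlog
  rcases le_total L ((n : ℝ) ^ (θ / 2)) with hsmall | hbig
  · refine .inl (log_mixingGap_le_two hγ hθ hL hn ?_)
    rw [← add_halves θ, Real.rpow_add (by exact_mod_cast hn), div_le_iff₀ hγ]
    rw [div_le_iff₀ hγ] at hlarge
    nlinarith [Real.rpow_nonneg (n.cast_nonneg : (0 : ℝ) ≤ n) (θ / 2)]
  · exact .inr ⟨hbig, log_mixingGap_le_mul_log hγ hθ hn (hlog.trans hbig) (hlarge'.trans hbig)⟩

end MixingGap

section Summability

theorem summable_exp_neg_rpow {c : ℝ} (hc : 0 < c) :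
    Summable fun n : ℕ => Real.exp (-(n : ℝ) ^ c) := by
  refine Summable.of_norm_bounded_eventually_nat (Real.summable_nat_rpow_inv.2 one_lt_two) ?_
  filter_upwards [eventually_log_natCast_le_mul_rpow one_half_pos hc, eventually_ge_atTop 1]
    with n hlog hn
  have hn0 : (0 : ℝ) < n := by exact_mod_cast hn
  rw [Real.norm_eq_abs, Real.abs_exp, ← Real.rpow_neg hn0.le, Real.rpow_def_of_pos hn0 (-2)]
  exact Real.exp_le_exp.2 (by linarith)

/-- The `n`-th term of the summability condition for real data: `D` is the dimension, `a` is
`sup_B Λ^*(∇Λ)`, `x` is `ξ(Bρ)`, and `δ n` is `δ_n(Λ,Φ)(Bρ)`. -/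
noncomputable def realBcTerm (D a x : ℝ) (k : ℕ → ℕ) (ε δ : ℕ → ℝ) (n : ℕ) : ℝ :=
  Real.exp (-√(ε n) * (Real.log (k n) - n * a)) * ε n ^ (-(D + 3 / 2)) *
    Real.exp (3 * n * (x * ε n + δ n))

variable {D a x γ θ : ℝ} {k : ℕ → ℕ} {ε δ : ℕ → ℝ} {n : ℕ}

theorem realBcTerm_eq_exp (hε : 0 < ε n) :
    realBcTerm D a x k ε δ n = Real.exp (-√(ε n) * (Real.log (k n) - n * a) +
      (D + 3 / 2) * -Real.log (ε n) + 3 * n * (x * ε n + δ n)) := by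
  rw [realBcTerm, Real.rpow_def_of_pos hε, ← Real.exp_add, ← Real.exp_add]
  congr 1
  ring

-- If `R` is at most half of `u * L`, the left side is below `-u * L / 4`, and `u ≥ 1 / log L`.
-- Otherwise `s` is at least of order `u * L / log L`.
theorem eventually_mul_log_le_or_le_neg_sqrt (A : ℝ) {C : ℝ} (hC : 0 < C) :
    ∀ᶠ L : ℝ in atTop, ∀ u s R : ℝ, 1 ≤ u * Real.log L → R ≤ C * Real.log L * s →
      u * (A * Real.log L) ≤ s ∨ u * (A * Real.log L) + R - u * L ≤ -√L := by
  have hlog : ∀ᶠ L : ℝ in atTop, 4 * A * Real.log L ≤ L :=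
    ((Real.isLittleO_log_id_atTop.const_mul_left (4 * A)).bound one_pos).mp
      ((eventually_ge_atTop 0).mono fun L hL h => by
        rw [one_mul, id, Real.norm_of_nonneg hL] at h
        exact (le_abs_self _).trans h)
  have hsq : ∀ᶠ L : ℝ in atTop, 2 * A * C * Real.log L ^ 2 ≤ L :=
    ((Real.isLittleO_pow_log_id_atTop.const_mul_left (2 * A * C)).bound one_pos).mp
      ((eventually_ge_atTop 0).mono fun L hL h => by
        rw [one_mul, id, Real.norm_of_nonneg hL] at h
        exact (le_abs_self _).trans h)
  have hsqrt : ∀ᶠ L : ℝ in atTop, 4 * Real.log L ≤ √L :=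
    (((isLittleO_log_rpow_atTop one_half_pos).const_mul_left 4).bound one_pos).mono fun L h => by
      rw [one_mul, ← Real.sqrt_eq_rpow, Real.norm_of_nonneg (Real.sqrt_nonneg L)] at h
      exact (le_abs_self _).trans h
  filter_upwards [hlog, hsq, hsqrt, eventually_gt_atTop 1] with L hlog hsq hsqrt hL u s R hu hR
  have hg : 0 < Real.log L := Real.log_pos hL
  have hu0 : 0 < u := pos_of_mul_pos_left (one_pos.trans_le hu) hg.le
  by_cases hhalf : R ≤ u * L / 2
  · right
    have h4 : 4 ≤ u * √L :=
      calc (4 : ℝ) ≤ 4 * (u * Real.log L) := by linarith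
        _ = u * (4 * Real.log L) := by ring
        _ ≤ u * √L := by gcongr
    have hsqrtL : 4 * √L ≤ u * L := by
      calc 4 * √L ≤ u * √L * √L := by gcongr
        _ = u * L := by rw [mul_assoc, Real.mul_self_sqrt (by linarith)]
    nlinarith [mul_le_mul_of_nonneg_left hlog hu0.le]
  · left
    have := mul_le_mul_of_nonneg_left hsq hu0.le
    refine le_of_mul_le_mul_right (a := 2 * C * Real.log L) ?_ (by positivity)
    linarith

-- The slack in the exponents is `s = l / 8 + n * (2 * (u ^ 2 * x) + δ / 2)`.
theorem eventually_mul_le_slack_or_le_neg_sqrt {A : ℝ} (hA : 0 ≤ A) (hD : 0 ≤ D) :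
    ∀ᶠ L : ℝ in atTop, ∀ a x δ u l n w : ℝ, 0 ≤ a → a ≤ x → 0 ≤ δ → 0 < u → 0 ≤ l → 0 ≤ n →
      w ≤ A * Real.log L →
      u * w ≤ A + (l / 8 + n * (2 * (u ^ 2 * x) + δ / 2)) ∨
        u * w + (n * (u * a) + (D + 3 / 2) * l + 3 * n * (x * u ^ 2 + δ)) - u * L ≤ -√L := by
  filter_upwards [eventually_mul_log_le_or_le_neg_sqrt A (C := 8 * (D + 3 / 2) + 1)
    (by positivity), Real.tendsto_log_atTop.eventually_ge_atTop 1]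
    with L hdichotomy hg a x δ u l n w ha hax hδ hu hl hn hw
  set s := l / 8 + n * (2 * (u ^ 2 * x) + δ / 2) with hs
  have hx : 0 ≤ x := ha.trans hax
  have hnx : 0 ≤ n * (u ^ 2 * x) := by positivity
  have hnδ : 0 ≤ n * δ := by positivity
  have huw : u * w ≤ u * (A * Real.log L) := by gcongr
  rcases le_total (u * Real.log L) 1 with hsmall | hbig
  · left
    nlinarith
  have hna : n * (u * a) ≤ s * Real.log L :=
    calc n * (u * a) ≤ n * (u * x) * 1 := by rw [mul_one]; gcongr
      _ ≤ n * (u * x) * (u * Real.log L) := by gcongr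
      _ = n * (u ^ 2 * x) * Real.log L := by ring
      _ ≤ s * Real.log L := by gcongr; rw [hs]; linarith
  have hrest : (D + 3 / 2) * l + 3 * n * (x * u ^ 2 + δ) ≤ 8 * (D + 3 / 2) * s := by
    rw [hs]
    nlinarith [mul_nonneg hD hnx, mul_nonneg hD hnδ]
  have hrest_log : 8 * (D + 3 / 2) * s ≤ 8 * (D + 3 / 2) * s * Real.log L :=
    le_mul_of_one_le_right (by positivity) hg
  rcases hdichotomy u s (n * (u * a) + (D + 3 / 2) * l + 3 * n * (x * u ^ 2 + δ)) hbig
    (by linarith) with h | h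
  · exact .inl (by linarith)
  · exact .inr (by linarith)

/-- The `n`-th term of the bound on the probability of a deviation of a truncated mean, with the
number of points of a net: `D`, `a`, `x` and `δ` are as in `realBcTerm`, and `q` is the gap. -/
noncomputable def momentTerm (D a x : ℝ) (q k : ℕ → ℕ) (ε δ : ℕ → ℝ) (n : ℕ) : ℝ :=
  ε n ^ (-(D + 1 / 4)) * (((q n : ℝ) / k n) ^ √(ε n) * ε n ^ (-(1 + √(ε n))) *
    Real.exp (n * (√(ε n) * a + ε n * x + 5 / 2 * δ n)))

theorem momentTerm_eq_exp {q : ℕ → ℕ} (hε : 0 < ε n) (hq : (0 : ℝ) < q n) (hk : (0 : ℝ) < k n) :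
    momentTerm D a x q k ε δ n = Real.exp (√(ε n) * Real.log (q n) - √(ε n) * Real.log (k n) +
      (D + 5 / 4 + √(ε n)) * -Real.log (ε n) + n * (√(ε n) * a + ε n * x + 5 / 2 * δ n)) := by
  rw [momentTerm, Real.rpow_def_of_pos hε, Real.rpow_def_of_pos hε,
    Real.rpow_def_of_pos (div_pos hq hk), Real.log_div hq.ne' hk.ne', ← Real.exp_add,
    ← Real.exp_add, ← Real.exp_add]
  congr 1
  ring

theorem eventually_mul_log_mixingGap_le (hγ : 0 < γ) (hθ : 0 < θ) (hD : 0 ≤ D) :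
    ∀ᶠ n : ℕ in atTop, ∀ L a x δ u l : ℝ, 0 ≤ L → 0 ≤ a → a ≤ x → 0 ≤ δ → 0 < u → u ≤ 1 → 0 ≤ l →
      u * Real.log (mixingGap γ θ L n) ≤ 1 / θ + 2 + (l / 8 + n * (2 * (u ^ 2 * x) + δ / 2)) ∨
        u * Real.log (mixingGap γ θ L n) +
            (n * (u * a) + (D + 3 / 2) * l + 3 * n * (x * u ^ 2 + δ)) - u * L ≤
          -(n : ℝ) ^ (θ / 4) := by
  obtain ⟨L₀, hL₀⟩ := eventually_atTop.1
    (eventually_mul_le_slack_or_le_neg_sqrt (A := 1 / θ + 1) (by positivity) hD)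
  filter_upwards [eventually_log_mixingGap_le hγ hθ,
    (tendsto_natCast_rpow_atTop (half_pos hθ)).eventually_ge_atTop L₀]
    with n hgap hnL₀ L a x δ u l hL ha hax hδ hu hu1 hl
  rcases hgap L hL with hw | ⟨hnL, hw⟩
  · have hx : 0 ≤ x := ha.trans hax
    have hs : 0 ≤ l / 8 + n * (2 * (u ^ 2 * x) + δ / 2) := by positivity
    have hθ' : 0 ≤ 1 / θ := by positivity
    exact .inl (by nlinarith)
  refine (hL₀ L (hnL₀.trans hnL) a x δ u l n _ ha hax hδ hu hl n.cast_nonneg hw).imp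
    (fun h => by linarith) fun h => h.trans (neg_le_neg ?_)
  calc (n : ℝ) ^ (θ / 4) = √((n : ℝ) ^ (θ / 2)) := by
        rw [Real.sqrt_eq_rpow, ← Real.rpow_mul n.cast_nonneg]
        ring_nf
    _ ≤ √L := Real.sqrt_le_sqrt hnL

theorem eventually_momentTerm_le (hγ : 0 < γ) (hθ : 0 < θ) (hD : 0 ≤ D) (ha : 0 ≤ a)
    (hax : a ≤ x) (hk : ∀ n, 1 ≤ n → 0 < k n) (hεpos : ∀ n, 1 ≤ n → 0 < ε n)
    (hε : Tendsto ε atTop (𝓝 0)) (hδ : ∀ n, 0 ≤ δ n) :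
    ∀ᶠ n in atTop, momentTerm D a x (fun n => mixingGap γ θ (Real.log (k n)) n) k ε δ n ≤
      Real.exp (1 / θ + 2) * realBcTerm D a x k ε δ n + Real.exp (-(n : ℝ) ^ (θ / 4)) := by
  filter_upwards [hε.eventually_lt_const (show (0 : ℝ) < 1 / 64 by norm_num),
    eventually_mul_log_mixingGap_le hγ hθ hD, eventually_ge_atTop 1] with n hε64 hslack hn
  have hε0 := hεpos n hn
  have hl : 0 ≤ -Real.log (ε n) := neg_nonneg.2 (Real.log_nonpos hε0.le (by linarith))
  have hu1 : √(ε n) ≤ 1 / 8 := Real.sqrt_le_iff.2 ⟨by norm_num, by linarith⟩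
  have hul : √(ε n) * -Real.log (ε n) ≤ 1 / 8 * -Real.log (ε n) := by gcongr
  rw [momentTerm_eq_exp (q := fun n => mixingGap γ θ (Real.log (k n)) n) hε0 mixingGap_pos
    (by exact_mod_cast hk n hn), realBcTerm_eq_exp hε0, ← Real.exp_add]
  rcases hslack _ a x (δ n) _ _ (Real.log_natCast_nonneg (k n)) ha hax (hδ n)
    (Real.sqrt_pos.2 hε0) (by linarith) hl with h | h <;> rw [Real.sq_sqrt hε0.le] at h
  · exact (Real.exp_le_exp.2 (by linarith)).trans (le_add_of_nonneg_right (Real.exp_pos _).le)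
  · have hnx : 0 ≤ n * (ε n * x) := by have := ha.trans hax; positivity
    have hnδ : 0 ≤ n * δ n := mul_nonneg n.cast_nonneg (hδ n)
    exact (Real.exp_le_exp.2 (by linarith)).trans (le_add_of_nonneg_left (Real.exp_pos _).le)

theorem summable_momentTerm (hγ : 0 < γ) (hθ : 0 < θ) (hD : 0 ≤ D) (ha : 0 ≤ a)
    (hax : a ≤ x) (hk : ∀ n, 1 ≤ n → 0 < k n) (hεpos : ∀ n, 1 ≤ n → 0 < ε n)
    (hε : Tendsto ε atTop (𝓝 0)) (hδ : ∀ n, 0 ≤ δ n) (hsum : Summable (realBcTerm D a x k ε δ)) :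
    Summable (momentTerm D a x (fun n => mixingGap γ θ (Real.log (k n)) n) k ε δ) := by
  refine Summable.of_norm_bounded_eventually_nat
    ((hsum.mul_left (Real.exp (1 / θ + 2))).add (summable_exp_neg_rpow (show 0 < θ / 4 by
      positivity))) ?_
  filter_upwards [eventually_momentTerm_le hγ hθ hD ha hax hk hεpos hε hδ, eventually_ge_atTop 1]
    with n hle hn
  rwa [Real.norm_of_nonneg]
  have hε0 := hεpos n hn
  rw [momentTerm]
  positivity

theorem eventually_mul_neg_log_le_log (ha : 0 ≤ a) (hx : 0 ≤ x)
    (hεpos : ∀ n, 1 ≤ n → 0 < ε n) (hε : Tendsto ε atTop (𝓝 0)) (hδ : ∀ n, 0 ≤ δ n)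
    (hsum : Summable (realBcTerm D a x k ε δ)) :
    ∀ᶠ n in atTop, (D + 3 / 2) * -Real.log (ε n) ≤ Real.log (k n) := by
  filter_upwards [hsum.tendsto_atTop_zero.eventually_lt_const one_pos,
    hε.eventually_lt_const one_pos, eventually_ge_atTop 1] with n hlt hε1 hn
  have hε0 := hεpos n hn
  have hL : 0 ≤ Real.log (k n) := Real.log_natCast_nonneg _
  rw [realBcTerm_eq_exp hε0, Real.exp_lt_one_iff] at hlt
  have huL : √(ε n) * Real.log (k n) ≤ 1 * Real.log (k n) := by
    gcongr
    exact Real.sqrt_le_one.2 hε1.le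
  have hrest : 0 ≤ 3 * n * (x * ε n + δ n) := by
    have := hδ n
    positivity
  have hua : 0 ≤ √(ε n) * (n * a) := by positivity
  linarith

theorem summable_mixing_term (hγ : 0 < γ) (hθ : 0 < θ) (hk : ∀ n, 1 ≤ n → 0 < k n)
    (hεpos : ∀ n, 1 ≤ n → 0 < ε n) (hε : Tendsto ε atTop (𝓝 0))
    (hlog : ∀ᶠ n in atTop, (D + 3 / 2) * -Real.log (ε n) ≤ Real.log (k n)) :
    Summable fun n : ℕ => ε n ^ (-(D + 1 / 4)) * (Real.exp (-γ *
      (((mixingGap γ θ (Real.log (k n)) n - 2) * n + 1 : ℕ) : ℝ) ^ θ) * (k n : ℝ) ^ 2) := by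
  refine Summable.of_norm_bounded_eventually_nat (Real.summable_nat_rpow_inv.2 one_lt_two) ?_
  filter_upwards [hlog, hε.eventually_lt_const one_pos, eventually_ge_atTop 1] with n hlog hε1 hn
  have hε0 := hεpos n hn
  have hn0 : (0 : ℝ) < n := by exact_mod_cast hn
  have hk0 : (0 : ℝ) < k n := by exact_mod_cast hk n hn
  have hl : 0 ≤ -Real.log (ε n) := neg_nonneg.2 (Real.log_nonpos hε0.le hε1.le)
  have hgap := four_mul_add_le_mixingGap hγ hθ (Real.log_natCast_nonneg (k n)) hn
  have hL : 0 ≤ Real.log (k n) := Real.log_natCast_nonneg _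
  have hsq : (k n : ℝ) ^ 2 = Real.exp (2 * Real.log (k n)) := by
    rw [two_mul, Real.exp_add, Real.exp_log hk0, sq]
  rw [Real.rpow_def_of_pos hε0, hsq, ← Real.exp_add, ← Real.exp_add, Real.norm_eq_abs,
    Real.abs_exp, ← Real.rpow_neg hn0.le, Real.rpow_def_of_pos hn0, Real.exp_le_exp]
  linarith

end Summability

section Blocks

variable {Ω : Type*} {E : Type*} [mE : MeasurableSpace E] {F : Type*} [MeasurableSpace F]
  {X : ℕ → Ω → E} {f : (ℕ → E) → F}

theorem comap_comp_shift_path_le (hf : Measurable f) {N s : ℕ} (hdep : DependsOn f (Set.Iio N))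
    {m : MeasurableSpace Ω} (hm : ∀ i, s ≤ i → i < s + N → mE.comap (X i) ≤ m) :
    .comap (fun ω => f (shift s (path X ω))) inferInstance ≤ m := by
  rw [← measurable_iff_comap_le]
  rcases isEmpty_or_nonempty Ω with hΩ | ⟨⟨ω₀⟩⟩
  · exact measurable_of_empty _
  let g : Ω → ℕ → E := fun ω i => if i < N then X (i + s) ω else X 0 ω₀
  have hg : Measurable[m] g := by
    refine @measurable_pi_lambda _ _ _ m _ g fun i => ?_
    by_cases hi : i < N
    · simp only [g, hi, if_true]
      exact (comap_measurable (X (i + s))).mono (hm _ (by omega) (by omega)) le_rfl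
    · simp only [g, hi, if_false]
      exact measurable_const
  have hfg : (fun ω => f (shift s (path X ω))) = f ∘ g := by
    funext ω
    refine hdep fun i hi => ?_
    simp only [g, if_pos (Set.mem_Iio.1 hi), shift, path]
  rw [hfg]
  exact hf.comp hg

variable [MeasurableSpace Ω] {P : Measure Ω}

theorem measurable_path (hX : ∀ i, Measurable (X i)) : Measurable (path X) :=
  measurable_pi_lambda _ hX

theorem measurable_shift (s : ℕ) : Measurable (shift (E := E) s) :=
  measurable_pi_lambda _ fun i => measurable_pi_apply (i + s)

theorem map_shift_path (hX : ∀ i, Measurable (X i)) (hstat : Stationary P X) (s : ℕ) :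
    P.map (fun ω => shift s (path X ω)) = P.map (path X) := by
  induction s with
  | zero => rfl
  | succ s ih =>
    have hcomp : (fun ω => shift (s + 1) (path X ω)) = shift 1 ∘ fun ω => shift s (path X ω) := by
      funext ω i
      simp only [shift, path, Function.comp, add_right_comm, add_assoc]
    have hmeas : Measurable fun ω => shift s (path X ω) :=
      (measurable_shift s).comp (measurable_path hX)
    rw [hcomp, ← Measure.map_map (measurable_shift 1) hmeas, ih,
      Measure.map_map (measurable_shift 1) (measurable_path hX)]
    exact hstat

theorem identDistrib_comp_shift_path (hf : Measurable f) (hX : ∀ i, Measurable (X i))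
    (hstat : Stationary P X) (s : ℕ) :
    IdentDistrib (fun ω => f (shift s (path X ω))) (fun ω => f (path X ω)) P P :=
  IdentDistrib.comp ⟨((measurable_shift s).comp (measurable_path hX)).aemeasurable,
    (measurable_path hX).aemeasurable, map_shift_path hX hstat s⟩ hf

variable [IsProbabilityMeasure P]

theorem alphaCoeff_le_alphaMix {m : ℕ} (hm : m ≠ 0) (i : ℕ) :
    alphaCoeff P (⨆ k : {k : ℕ // k ≤ i}, mE.comap (X k))
      (⨆ j : {j : ℕ // i + m ≤ j}, mE.comap (X j)) ≤ alphaMix P X m := by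
  rw [alphaMix, if_neg hm]
  refine le_ciSup (f := fun i : ℕ => alphaCoeff P (⨆ k : {k : ℕ // k ≤ i}, mE.comap (X k))
    (⨆ j : {j : ℕ // i + m ≤ j}, mE.comap (X j))) ⟨1, ?_⟩ i
  rintro _ ⟨i, rfl⟩
  exact alphaCoeff_le_one

theorem alphaCoeff_block_le_alphaMix (hf : Measurable f) {n : ℕ}
    (hdep : DependsOn f (Set.Iio (2 * n))) {q i j : ℕ} (hq : 2 ≤ q) (hij : i + q ≤ j) :
    alphaCoeff P (.comap (fun ω => f (shift (i * n) (path X ω))) inferInstance)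
      (.comap (fun ω => f (shift (j * n) (path X ω))) inferInstance) ≤
    alphaMix P X ((q - 2) * n + 1) := by
  obtain ⟨r, rfl⟩ := Nat.exists_eq_add_of_le hq
  have hjn : i * n + 2 * n + r * n ≤ j * n := by
    have := Nat.mul_le_mul_right n hij
    linarith
  refine (alphaCoeff_mono ?_ ?_).trans
    (alphaCoeff_le_alphaMix (Nat.succ_ne_zero _) (i * n + 2 * n - 1))
  · refine comap_comp_shift_path_le hf hdep fun l _ hl => ?_
    exact le_iSup (fun k : {k : ℕ // k ≤ i * n + 2 * n - 1} => mE.comap (X k)) ⟨l, by omega⟩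
  · refine comap_comp_shift_path_le hf hdep fun l hl _ => ?_
    refine le_iSup (fun k : {k : ℕ // i * n + 2 * n - 1 + ((2 + r - 2) * n + 1) ≤ k} =>
      mE.comap (X k)) ⟨l, ?_⟩
    rw [Nat.add_sub_cancel_left]
    omega

end Blocks

section ApproxErr

variable {E : Type*} {d : ℕ} {S S' : ℕ → (ℕ → E) → EuclideanSpace ℝ (Fin d)} {n : ℕ}
  {B : Set (EuclideanSpace ℝ (Fin d))} {l : EuclideanSpace ℝ (Fin d)}

theorem norm_sub_le_natCast_mul_approxErr (hn : 1 ≤ n) (happ : approxErr S S' n ≠ ⊤) (z : ℕ → E) :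
    ‖S n z - S' n z‖ ≤ n * (approxErr S S' n).toReal := by
  have hn0 : (n : ℝ≥0∞) ≠ 0 := by exact_mod_cast Nat.one_le_iff_ne_zero.1 hn
  have hle : ‖S n z - S' n z‖ₑ ≤ n * approxErr S S' n := by
    rw [approxErr, ENNReal.mul_div_cancel hn0 (ENNReal.natCast_ne_top n)]
    exact le_iSup (fun z => ‖S n z - S' n z‖ₑ) z
  have hreal := ENNReal.toReal_mono (ENNReal.mul_ne_top (ENNReal.natCast_ne_top n) happ) hle
  rwa [toReal_enorm, ENNReal.toReal_mul, ENNReal.toReal_natCast] at hreal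

theorem abs_inner_sub_inner_le (hn : 1 ≤ n) (happ : approxErr S S' n ≠ ⊤)
    (l : EuclideanSpace ℝ (Fin d)) (z : ℕ → E) :
    |inner ℝ l (S n z) - inner ℝ l (S' n z)| ≤ n * (‖l‖ * (approxErr S S' n).toReal) := by
  calc |inner ℝ l (S n z) - inner ℝ l (S' n z)| ≤ ‖l‖ * ‖S n z - S' n z‖ := by
        rw [← inner_sub_right]
        exact abs_real_inner_le_norm _ _
    _ ≤ ‖l‖ * (n * (approxErr S S' n).toReal) := by
        gcongr
        exact norm_sub_le_natCast_mul_approxErr hn happ z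
    _ = n * (‖l‖ * (approxErr S S' n).toReal) := by ring

theorem deltaPhi_ne_top (hB : Bornology.IsBounded B) (happ : approxErr S S' n ≠ ⊤) :
    deltaPhi S S' B n ≠ ⊤ := by
  obtain ⟨R, hR⟩ := hB.exists_norm_le
  refine ENNReal.mul_ne_top (ne_top_of_le_ne_top ENNReal.ofReal_ne_top
    (iSup₂_le fun l hl => ?_ : _ ≤ ENNReal.ofReal R)) happ
  rw [← ofReal_norm]
  exact ENNReal.ofReal_le_ofReal (hR l hl)

theorem norm_mul_approxErr_le (hB : Bornology.IsBounded B) (happ : approxErr S S' n ≠ ⊤)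
    (hl : l ∈ B) : ‖l‖ * (approxErr S S' n).toReal ≤ (deltaPhi S S' B n).toReal := by
  have hle : ‖l‖ₑ * approxErr S S' n ≤ deltaPhi S S' B n := by
    rw [deltaPhi]
    gcongr
    exact le_iSup₂ (f := fun l (_ : l ∈ B) => ‖l‖ₑ) l hl
  have hreal := ENNReal.toReal_mono (deltaPhi_ne_top hB happ) hle
  rwa [ENNReal.toReal_mul, toReal_enorm] at hreal

end ApproxErr

section Pressure

variable {Ω : Type*} [MeasurableSpace Ω] {E : Type*} {d : ℕ}
  {P : Measure Ω} {X : ℕ → Ω → E} {S S' : ℕ → (ℕ → E) → EuclideanSpace ℝ (Fin d)} {n : ℕ}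
  {D A : Set (EuclideanSpace ℝ (Fin d))} {l : EuclideanSpace ℝ (Fin d)}

/-- `Λ_n` as a real-valued function, for use where the exponential moment is finite. -/
noncomputable def realLambdaN (P : Measure Ω) (X : ℕ → Ω → E)
    (S : ℕ → (ℕ → E) → EuclideanSpace ℝ (Fin d)) (n : ℕ) (l : EuclideanSpace ℝ (Fin d)) : ℝ :=
  Real.log (∫ ω, Real.exp (inner ℝ l (S n (path X ω))) ∂P) / n

theorem lambdaN_eq_coe [NeZero P]
    (hint : Integrable (fun ω => Real.exp (inner ℝ l (S n (path X ω)))) P) :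
    LambdaN P X S n l = (realLambdaN P X S n l : EReal) := by
  rw [LambdaN, realLambdaN,
    ← ofReal_integral_eq_lintegral_ofReal hint (ae_of_all _ fun ω => (Real.exp_pos _).le),
    ENNReal.log_ofReal_of_pos (integral_exp_pos hint), EReal.coe_div]
  rfl

theorem convexOn_realLambdaN [NeZero P] {s : Set (EuclideanSpace ℝ (Fin d))} (hs : Convex ℝ s)
    (hint : ∀ l ∈ s, Integrable (fun ω => Real.exp (inner ℝ l (S n (path X ω)))) P) :
    ConvexOn ℝ s (realLambdaN P X S n) := by
  refine ((convexOn_log_integral_exp_inner hs hint).smul (inv_nonneg.2 n.cast_nonneg)).congr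
    fun l _ => ?_
  simp only [realLambdaN, smul_eq_mul, inv_mul_eq_div]

theorem lambdaLim_eq_coe (hlim : HasFiniteLimitOn P X S D) (hl : l ∈ D) :
    LambdaLim P X S l = (LambdaReal P X S l : EReal) := by
  obtain ⟨r, hr⟩ := hlim.2.2 l hl
  rw [LambdaReal, show LambdaLim P X S l = r from hr.limsup_eq, EReal.toReal_coe]

theorem tendsto_lambdaN (hlim : HasFiniteLimitOn P X S D) (hl : l ∈ D) :
    Tendsto (fun n => LambdaN P X S n l) atTop (𝓝 (LambdaReal P X S l : EReal)) := by
  obtain ⟨r, hr⟩ := hlim.2.2 l hl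
  rwa [← lambdaLim_eq_coe hlim hl, show LambdaLim P X S l = r from hr.limsup_eq]

theorem exp_inner_rpow (l v : EuclideanSpace ℝ (Fin d)) (τ : ℝ) :
    Real.exp (inner ℝ l v) ^ (1 + τ) = Real.exp (inner ℝ (l + τ • l) v) := by
  rw [← Real.exp_mul, inner_add_left, real_inner_smul_left]
  ring_nf

theorem moment_ratio_eq_exp [NeZero P] (hn : 1 ≤ n) (τ : ℝ)
    (hint : Integrable (fun ω => Real.exp (inner ℝ l (S n (path X ω)))) P)
    (hintτ : Integrable (fun ω => Real.exp (inner ℝ (l + τ • l) (S n (path X ω)))) P) :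
    (∫ ω, Real.exp (inner ℝ l (S n (path X ω))) ^ (1 + τ) ∂P) /
      (∫ ω, Real.exp (inner ℝ l (S n (path X ω))) ∂P) ^ (1 + τ) =
    Real.exp (n * (realLambdaN P X S n (l + τ • l) - (1 + τ) * realLambdaN P X S n l)) := by
  have hn0 : (n : ℝ) ≠ 0 := by exact_mod_cast Nat.one_le_iff_ne_zero.1 hn
  have hpos := integral_exp_pos hint
  simp only [exp_inner_rpow, realLambdaN]
  rw [Real.rpow_def_of_pos hpos, ← Real.exp_log (integral_exp_pos hintτ), ← Real.exp_sub]
  simp only [Real.exp_log (integral_exp_pos hintτ)]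
  congr 1
  field_simp

variable [MeasurableSpace E]

theorem integrable_of_lambdaN_ne_top (hX : ∀ i, Measurable (X i)) (hn : 1 ≤ n)
    (hS : Measurable (S n)) (hfin : LambdaN P X S n l ≠ ⊤) :
    Integrable (fun ω => Real.exp (inner ℝ l (S n (path X ω)))) P := by
  have hmeas : Measurable fun ω => Real.exp (inner ℝ l (S n (path X ω))) :=
    (hS.comp (measurable_path hX)).const_inner.exp
  rw [← lintegral_ofReal_ne_top_iff_integrable hmeas.aestronglyMeasurable
    (ae_of_all _ fun ω => (Real.exp_pos _).le)]
  refine fun htop => hfin ?_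
  rw [LambdaN, htop, ENNReal.log_top]
  exact EReal.top_div_of_pos_ne_top (by exact_mod_cast hn) (EReal.natCast_ne_top n)

theorem eventually_integrable_exp (hX : ∀ i, Measurable (X i))
    (hS : ∀ n, 1 ≤ n → Measurable (S n)) (hlim : HasFiniteLimitOn P X S D) (hl : l ∈ D) :
    ∀ᶠ n in atTop, Integrable (fun ω => Real.exp (inner ℝ l (S n (path X ω)))) P := by
  filter_upwards [(tendsto_lambdaN hlim hl).eventually_ne (EReal.coe_ne_top _),
    eventually_ge_atTop 1] with n hfin hn
  exact integrable_of_lambdaN_ne_top hX hn (hS n hn) hfin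

theorem tendsto_realLambdaN [NeZero P] (hX : ∀ i, Measurable (X i))
    (hS : ∀ n, 1 ≤ n → Measurable (S n)) (hlim : HasFiniteLimitOn P X S D) (hl : l ∈ D) :
    Tendsto (fun n => realLambdaN P X S n l) atTop (𝓝 (LambdaReal P X S l)) := by
  rw [← EReal.tendsto_coe]
  exact (tendsto_lambdaN hlim hl).congr'
    ((eventually_integrable_exp hX hS hlim hl).mono fun n hint => lambdaN_eq_coe hint)

theorem convexOn_lambdaReal [NeZero P] (hX : ∀ i, Measurable (X i))
    (hS : ∀ n, 1 ≤ n → Measurable (S n)) (hlim : HasFiniteLimitOn P X S D) :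
    ConvexOn ℝ D (LambdaReal P X S) := by
  refine ⟨hlim.1, fun x hx y hy a b ha hb hab => ?_⟩
  refine le_of_tendsto_of_tendsto
    (tendsto_realLambdaN hX hS hlim (hlim.1 hx hy ha hb hab))
    (((tendsto_realLambdaN hX hS hlim hx).const_mul a).add
      ((tendsto_realLambdaN hX hS hlim hy).const_mul b)) ?_
  filter_upwards [eventually_integrable_exp hX hS hlim hx,
    eventually_integrable_exp hX hS hlim hy] with n hnx hny
  exact (convexOn_realLambdaN
    (convex_setOf_integrable_exp_inner P fun ω => S n (path X ω)) fun l hl => hl).2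
    hnx hny ha hb hab

theorem integrable_of_approxErr_ne_top (hX : ∀ i, Measurable (X i)) (hn : 1 ≤ n)
    (hS' : Measurable (S' n)) (happ : approxErr S S' n ≠ ⊤)
    (hint : Integrable (fun ω => Real.exp (inner ℝ l (S n (path X ω)))) P) :
    Integrable (fun ω => Real.exp (inner ℝ l (S' n (path X ω)))) P :=
  integrable_exp_of_abs_sub_le (hS'.comp (measurable_path hX)).const_inner.aemeasurable
    (fun ω => abs_inner_sub_inner_le hn happ l (path X ω)) hint

theorem abs_realLambdaN_sub_realLambdaN_le [NeZero P] (hX : ∀ i, Measurable (X i)) (hn : 1 ≤ n)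
    (hS' : Measurable (S' n)) (happ : approxErr S S' n ≠ ⊤)
    (hint : Integrable (fun ω => Real.exp (inner ℝ l (S n (path X ω)))) P) :
    |realLambdaN P X S n l - realLambdaN P X S' n l| ≤ ‖l‖ * (approxErr S S' n).toReal := by
  have hn0 : (0 : ℝ) < n := by exact_mod_cast hn
  rw [realLambdaN, realLambdaN, ← sub_div, abs_div, abs_of_pos hn0, div_le_iff₀' hn0]
  exact abs_log_integral_exp_sub_le (fun ω => abs_inner_sub_inner_le hn happ l (path X ω)) hint
    (integrable_of_approxErr_ne_top hX hn hS' happ hint)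

theorem integrable_of_deltaLambda_ne_top (hX : ∀ i, Measurable (X i)) (hn : 1 ≤ n)
    (hS : Measurable (S n)) (hlim : HasFiniteLimitOn P X S D) (hAD : A ⊆ D) (hl : l ∈ A)
    (hδ : deltaLambda P X S A n ≠ ⊤) :
    Integrable (fun ω => Real.exp (inner ℝ l (S n (path X ω)))) P := by
  refine integrable_of_lambdaN_ne_top hX hn hS fun htop => hδ (top_le_iff.1 ?_)
  refine le_trans ?_ (le_iSup₂
    (f := fun l (_ : l ∈ A) => (LambdaLim P X S l - LambdaN P X S n l).abs) l hl)
  rw [htop, lambdaLim_eq_coe hlim (hAD hl), EReal.sub_top, EReal.abs_bot]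

theorem abs_lambdaReal_sub_realLambdaN_le [NeZero P] (hX : ∀ i, Measurable (X i)) (hn : 1 ≤ n)
    (hS : Measurable (S n)) (hlim : HasFiniteLimitOn P X S D) (hAD : A ⊆ D) (hl : l ∈ A)
    (hδ : deltaLambda P X S A n ≠ ⊤) :
    |LambdaReal P X S l - realLambdaN P X S n l| ≤ (deltaLambda P X S A n).toReal := by
  rw [← ENNReal.ofReal_le_iff_le_toReal hδ, ← EReal.abs_def, EReal.coe_sub,
    ← lambdaN_eq_coe (integrable_of_deltaLambda_ne_top hX hn hS hlim hAD hl hδ),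
    ← lambdaLim_eq_coe hlim (hAD hl)]
  exact le_iSup₂ (f := fun l (_ : l ∈ A) => (LambdaLim P X S l - LambdaN P X S n l).abs) l hl

theorem integrable_of_deltaTot_ne_top (hX : ∀ i, Measurable (X i)) (hn : 1 ≤ n)
    (hS : Measurable (S n)) (hS' : Measurable (S' n)) (hlim : HasFiniteLimitOn P X S D)
    (hAD : A ⊆ D) (hl : l ∈ A) (happ : approxErr S S' n ≠ ⊤) (hδ : deltaTot P X S S' A n ≠ ⊤) :
    Integrable (fun ω => Real.exp (inner ℝ l (S' n (path X ω)))) P :=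
  integrable_of_approxErr_ne_top hX hn hS' happ
    (integrable_of_deltaLambda_ne_top hX hn hS hlim hAD hl (ENNReal.add_ne_top.1 hδ).1)

theorem abs_lambdaReal_sub_realLambdaN_le_deltaTot [NeZero P] (hX : ∀ i, Measurable (X i))
    (hn : 1 ≤ n) (hS : Measurable (S n)) (hS' : Measurable (S' n))
    (hlim : HasFiniteLimitOn P X S D) (hAD : A ⊆ D) (hA : Bornology.IsBounded A) (hl : l ∈ A)
    (happ : approxErr S S' n ≠ ⊤) (hδ : deltaTot P X S S' A n ≠ ⊤) :
    |LambdaReal P X S l - realLambdaN P X S' n l| ≤ (deltaTot P X S S' A n).toReal := by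
  obtain ⟨hδΛ, hδΦ⟩ := ENNReal.add_ne_top.1 hδ
  have hint := integrable_of_deltaLambda_ne_top hX hn hS hlim hAD hl hδΛ
  rw [deltaTot, ENNReal.toReal_add hδΛ hδΦ]
  exact (abs_sub_le _ (realLambdaN P X S n l) _).trans (add_le_add
    (abs_lambdaReal_sub_realLambdaN_le hX hn hS hlim hAD hl hδΛ)
    ((abs_realLambdaN_sub_realLambdaN_le hX hn hS' happ hint).trans
      (norm_mul_approxErr_le hA happ hl)))

theorem moment_ratio_le [NeZero P] (hX : ∀ i, Measurable (X i)) (hn : 1 ≤ n)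
    (hS : Measurable (S n)) (hS' : Measurable (S' n)) (hlim : HasFiniteLimitOn P X S D)
    (hC2 : ContDiffOn ℝ 2 (LambdaReal P X S) D) (hAD : A ⊆ D) (hA : Bornology.IsBounded A)
    (happ : approxErr S S' n ≠ ⊤) (hδ : deltaTot P X S S' A n ≠ ⊤) {a x τ : ℝ} (hτ0 : 0 ≤ τ)
    (hτ : τ ≤ 1 / 4) (hx0 : 0 ≤ x) (hseg : ∀ t ∈ Set.Icc 0 τ, l + t • l ∈ A)
    (ha : fderiv ℝ (LambdaReal P X S) l l - LambdaReal P X S l ≤ a)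
    (hx : ∀ l ∈ A, 1 / 2 * fderiv ℝ (fderiv ℝ (LambdaReal P X S)) l l l ≤ x) :
    (∫ ω, Real.exp (inner ℝ l (S' n (path X ω))) ^ (1 + τ) ∂P) /
      (∫ ω, Real.exp (inner ℝ l (S' n (path X ω))) ∂P) ^ (1 + τ) ≤
      Real.exp (n * (τ * a + τ ^ 2 * x + 5 / 2 * (deltaTot P X S S' A n).toReal)) := by
  have hlA : l ∈ A := by simpa using hseg 0 ⟨le_rfl, hτ0⟩
  have hτA : l + τ • l ∈ A := hseg τ ⟨hτ0, le_rfl⟩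
  have hclose := abs_lambdaReal_sub_realLambdaN_le_deltaTot hX hn hS hS' hlim hAD hA hlA happ hδ
  have hcloseτ := abs_lambdaReal_sub_realLambdaN_le_deltaTot hX hn hS hS' hlim hAD hA hτA happ hδ
  have htaylor : LambdaReal P X S (l + τ • l) ≤ LambdaReal P X S l +
      τ * fderiv ℝ (LambdaReal P X S) l l + τ ^ 2 * x :=
    le_taylor_radial hlim.2.1 hC2 hτ0 hx0 (fun t ht => hAD (hseg t ht))
      fun t ht => hx _ (hseg t ht)
  rw [moment_ratio_eq_exp hn τ
    (integrable_of_deltaTot_ne_top hX hn hS hS' hlim hAD hlA happ hδ)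
    (integrable_of_deltaTot_ne_top hX hn hS hS' hlim hAD hτA happ hδ), Real.exp_le_exp]
  set δ := (deltaTot P X S S' A n).toReal
  have hδ0 : 0 ≤ δ := ENNReal.toReal_nonneg
  have hτδ : τ * δ ≤ 1 / 4 * δ := by gcongr
  have hτa := mul_le_mul_of_nonneg_left ha hτ0
  have hτclose := mul_le_mul_of_nonneg_left (abs_le.1 hclose).2 (show 0 ≤ 1 + τ by linarith)
  gcongr
  linarith [(abs_le.1 hcloseτ).1]

end Pressure

section SummabilityCondition

variable {Ω : Type*} [MeasurableSpace Ω] {E : Type*} {d : ℕ} {P : Measure Ω} {X : ℕ → Ω → E}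
  {S S' : ℕ → (ℕ → E) → EuclideanSpace ℝ (Fin d)} {A B D : Set (EuclideanSpace ℝ (Fin d))}
  {l : EuclideanSpace ℝ (Fin d)} {k : ℕ → ℕ} {ε : ℕ → ℝ} {n : ℕ}

theorem inner_gradient_eq (f : EuclideanSpace ℝ (Fin d) → ℝ) (l v : EuclideanSpace ℝ (Fin d)) :
    inner ℝ v (gradient f l) = fderiv ℝ f l v := by
  rw [real_inner_comm, gradient, InnerProductSpace.toDual_symm_apply]

theorem inner_gradient_sub_le_lambdaStarSup (hl : l ∈ A) (l' : EuclideanSpace ℝ (Fin d)) :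
    ((inner ℝ l' (gradient (LambdaReal P X S) l) : ℝ) : EReal) - LambdaLim P X S l' ≤
      LambdaStarSup P X S A :=
  (le_iSup (fun l' : EuclideanSpace ℝ (Fin d) =>
    ((inner ℝ l' (gradient (LambdaReal P X S) l) : ℝ) : EReal) - LambdaLim P X S l') l').trans
    (le_iSup₂ (f := fun l (_ : l ∈ A) => LambdaStar P X S (gradient (LambdaReal P X S) l)) l hl)

theorem fderiv_sub_le_lambdaStarSup (hlim : HasFiniteLimitOn P X S D) (hAD : A ⊆ D) (hl : l ∈ A) :
    ((fderiv ℝ (LambdaReal P X S) l l - LambdaReal P X S l : ℝ) : EReal) ≤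
      LambdaStarSup P X S A := by
  rw [EReal.coe_sub, ← lambdaLim_eq_coe hlim (hAD hl), ← inner_gradient_eq]
  exact inner_gradient_sub_le_lambdaStarSup hl l

theorem lambdaLim_zero [IsProbabilityMeasure P] : LambdaLim P X S 0 = 0 := by
  have hzero : Tendsto (fun n => LambdaN P X S n 0) atTop (𝓝 0) := by
    simp [LambdaN]
  exact hzero.limsup_eq

theorem lambdaStarSup_nonneg [IsProbabilityMeasure P] (hA : A.Nonempty) :
    0 ≤ LambdaStarSup P X S A := by
  obtain ⟨l, hl⟩ := hA
  simpa [lambdaLim_zero] using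
    inner_gradient_sub_le_lambdaStarSup (P := P) (X := X) (S := S) hl 0

theorem fderiv_fderiv_le_xi2 (hl : l ∈ A) :
    ((1 / 2 * fderiv ℝ (fderiv ℝ (LambdaReal P X S)) l l l : ℝ) : EReal) ≤ xi2 P X S A :=
  le_iSup₂ (f := fun l (_ : l ∈ A) =>
    ((1 / 2 * fderiv ℝ (fderiv ℝ (LambdaReal P X S)) l l l : ℝ) : EReal)) l hl

theorem xi2_nonneg [NeZero P] [MeasurableSpace E] (hX : ∀ i, Measurable (X i))
    (hS : ∀ n, 1 ≤ n → Measurable (S n)) (hlim : HasFiniteLimitOn P X S D)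
    (hC2 : ContDiffOn ℝ 2 (LambdaReal P X S) D) (hA : A.Nonempty) (hAD : A ⊆ D) :
    0 ≤ xi2 P X S A := by
  obtain ⟨l, hl⟩ := hA
  have hhess := fderiv_fderiv_nonneg_of_convexOn hlim.2.1 hC2 (convexOn_lambdaReal hX hS hlim)
    (hAD hl) l
  exact (EReal.coe_nonneg.2 (by positivity)).trans (fderiv_fderiv_le_xi2 hl)

-- Discarding `Λ^*` and the factor `3 * n` from the exponents only decreases the term.
theorem xi_mul_add_deltaTot_ne_top (hstar : 0 ≤ LambdaStarSup P X S B) (hxi : 0 ≤ xi P X S A)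
    (hn : 1 ≤ n) (hε : 0 < ε n) (hfin : bcTerm P X S S' B A k ε n ≠ ⊤) :
    xi P X S A * (ε n : EReal) + (deltaTot P X S S' A n : EReal) ≠ ⊤ := by
  set y := xi P X S A * (ε n : EReal) + (deltaTot P X S S' A n : EReal) with hy
  have hy0 : 0 ≤ y := add_nonneg (mul_nonneg hxi (EReal.coe_nonneg.2 hε.le))
    (EReal.coe_ennreal_nonneg _)
  have hexponent : ((-√(ε n) * Real.log (k n) : ℝ) : EReal) ≤
      -((√(ε n) : ℝ) : EReal) * ((Real.log (k n) : EReal) - n * LambdaStarSup P X S B) := by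
    rw [neg_mul, EReal.coe_neg, EReal.coe_mul, EReal.neg_mul, EReal.neg_le_neg_iff]
    refine mul_le_mul_of_nonneg_left ?_ (EReal.coe_nonneg.2 (Real.sqrt_nonneg _))
    exact (EReal.sub_le_sub le_rfl (mul_nonneg (by positivity) hstar)).trans (by simp)
  have hthree : y ≤ 3 * (n : EReal) * y := by
    refine le_mul_of_one_le_left hy0 ?_
    have : (1 : ℝ) ≤ 3 * n := by
      have : (1 : ℝ) ≤ n := by exact_mod_cast hn
      linarith
    exact_mod_cast this
  intro htop
  refine hfin (top_le_iff.1 ?_)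
  calc
    ⊤ = EReal.exp ((-√(ε n) * Real.log (k n) : ℝ) : EReal) *
        ENNReal.ofReal (ε n ^ (-((d : ℝ) + 3 / 2))) * EReal.exp y := by
      rw [htop, EReal.exp_top, ENNReal.mul_top]
      rw [EReal.exp_coe, ← ENNReal.ofReal_mul (Real.exp_pos _).le]
      exact (ENNReal.ofReal_pos.2 (by positivity)).ne'
    _ ≤ bcTerm P X S S' B A k ε n := by
      rw [bcTerm, ← hy]
      gcongr

theorem xi_ne_top_and_deltaTot_ne_top (hstar : 0 ≤ LambdaStarSup P X S B) (hxi : 0 ≤ xi P X S A)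
    (hn : 1 ≤ n) (hε : 0 < ε n) (hfin : bcTerm P X S S' B A k ε n ≠ ⊤) :
    xi P X S A ≠ ⊤ ∧ deltaTot P X S S' A n ≠ ⊤ := by
  have hsum := xi_mul_add_deltaTot_ne_top hstar hxi hn hε hfin
  refine ⟨fun htop => hsum ?_, fun htop => hsum ?_⟩
  · rw [htop, EReal.top_mul_coe_of_pos hε, EReal.top_add_of_ne_bot (EReal.coe_ennreal_ne_bot _)]
  · rw [htop, EReal.coe_ennreal_top, EReal.add_top_of_ne_bot]
    exact (EReal.bot_lt_zero.trans_le (mul_nonneg hxi (EReal.coe_nonneg.2 hε.le))).ne'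

theorem bcTerm_eq_ofReal {a x : ℝ} (ha : LambdaStarSup P X S B = a) (hx : xi P X S A = x)
    (hε : 0 < ε n) (hδ : deltaTot P X S S' A n ≠ ⊤) :
    bcTerm P X S S' B A k ε n = ENNReal.ofReal
      (realBcTerm d a x k ε (fun n => (deltaTot P X S S' A n).toReal) n) := by
  have hcoe : ((deltaTot P X S S' A n : ℝ≥0∞) : EReal) =
      (((deltaTot P X S S' A n).toReal : ℝ) : EReal) := (EReal.coe_ennreal_toReal hδ).symm
  rw [realBcTerm, ENNReal.ofReal_mul (by positivity), ENNReal.ofReal_mul (by positivity), bcTerm,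
    ha, hx, hcoe, ← EReal.exp_coe, ← EReal.exp_coe]
  congr 2

theorem exists_summable_realBcTerm [IsProbabilityMeasure P] [MeasurableSpace E]
    (hX : ∀ i, Measurable (X i)) (hS : ∀ n, 1 ≤ n → Measurable (S n))
    (hlim : HasFiniteLimitOn P X S D) (hC2 : ContDiffOn ℝ 2 (LambdaReal P X S) D)
    (hB : B.Nonempty) (hBA : B ⊆ A) (hAD : A ⊆ D) (hεpos : ∀ n, 1 ≤ n → 0 < ε n)
    (hBC : ∑' n : ℕ, bcTerm P X S S' B A k ε (n + 1) < ∞) :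
    ∃ a x : ℝ, 0 ≤ a ∧ a ≤ x ∧
      (∀ l ∈ B, fderiv ℝ (LambdaReal P X S) l l - LambdaReal P X S l ≤ a) ∧
      (∀ l ∈ A, 1 / 2 * fderiv ℝ (fderiv ℝ (LambdaReal P X S)) l l l ≤ x) ∧
      (∀ n, 1 ≤ n → deltaTot P X S S' A n ≠ ⊤) ∧
      Summable (realBcTerm d a x k ε fun n => (deltaTot P X S S' A n).toReal) := by
  have hstarB : 0 ≤ LambdaStarSup P X S B := lambdaStarSup_nonneg hB
  have hstarA : 0 ≤ LambdaStarSup P X S A := lambdaStarSup_nonneg (hB.mono hBA)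
  have hxi2 : 0 ≤ xi2 P X S A := xi2_nonneg hX hS hlim hC2 (hB.mono hBA) hAD
  have hstar_le : LambdaStarSup P X S B ≤ xi P X S A :=
    (biSup_mono hBA).trans (le_add_of_nonneg_right hxi2)
  have hfin : ∀ n, 1 ≤ n → xi P X S A ≠ ⊤ ∧ deltaTot P X S S' A n ≠ ⊤ := fun n hn => by
    refine xi_ne_top_and_deltaTot_ne_top hstarB (add_nonneg hstarA hxi2) hn (hεpos n hn)
      (k := k) (n := n) ?_
    obtain ⟨m, rfl⟩ := Nat.exists_eq_add_of_le' hn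
    exact ENNReal.ne_top_of_tsum_ne_top hBC.ne m
  have hxi_top := (hfin 1 le_rfl).1
  obtain ⟨a, ha⟩ : ∃ a : ℝ, LambdaStarSup P X S B = a := ⟨_, (EReal.coe_toReal
    (hstar_le.trans_lt hxi_top.lt_top).ne (EReal.bot_lt_zero.trans_le hstarB).ne').symm⟩
  obtain ⟨x, hx⟩ : ∃ x : ℝ, xi P X S A = x := ⟨_, (EReal.coe_toReal hxi_top
    (EReal.bot_lt_zero.trans_le (hstarB.trans hstar_le)).ne').symm⟩
  refine ⟨a, x, ?_, ?_, fun l hl => ?_, fun l hl => ?_, fun n hn => (hfin n hn).2, ?_⟩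
  · exact EReal.coe_nonneg.1 (ha ▸ hstarB)
  · exact EReal.coe_le_coe_iff.1 (by rwa [← ha, ← hx])
  · exact EReal.coe_le_coe_iff.1 (ha ▸ fderiv_sub_le_lambdaStarSup hlim (hBA.trans hAD) hl)
  · exact EReal.coe_le_coe_iff.1
      (hx ▸ (fderiv_fderiv_le_xi2 hl).trans (le_add_of_nonneg_left hstarA))
  · rw [← summable_nat_add_iff 1]
    refine (ENNReal.summable_toReal hBC.ne).congr fun n => ?_
    have hε0 := hεpos (n + 1) (Nat.succ_pos n)
    rw [bcTerm_eq_ofReal ha hx hε0 (hfin _ (Nat.succ_pos n)).2, ENNReal.toReal_ofReal]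
    rw [realBcTerm]
    positivity

end SummabilityCondition

section Empirical

variable {Ω : Type*} {E : Type*} {d : ℕ} {X : ℕ → Ω → E}
  {S S' : ℕ → (ℕ → E) → EuclideanSpace ℝ (Fin d)} {k : ℕ → ℕ} {n : ℕ}

theorem lambdaEmp_eq_log_average (hn : 1 ≤ n) (ω : Ω) (l : EuclideanSpace ℝ (Fin d)) :
    LambdaEmp X S k n ω l = Real.log ((k n : ℝ)⁻¹ * ∑ i ∈ Finset.range (k n),
      Real.exp (inner ℝ l (S n (shift (i * n) (path X ω))))) / n := by
  have hn0 : (n : ℝ) ≠ 0 := by exact_mod_cast Nat.one_le_iff_ne_zero.1 hn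
  rw [LambdaEmp, empMeasure, integral_smul_measure, integral_finsetSum_measure]
  · simp only [integral_dirac, real_inner_smul_right, mul_inv_cancel_left₀ hn0, smul_eq_mul,
      ENNReal.toReal_inv, ENNReal.toReal_natCast]
    ring
  · exact fun i _ => integrable_dirac (by simp)

theorem lambdaEmp_eq_log_integral_count (hn : 1 ≤ n) (hk : 0 < k n) (ω : Ω)
    (l : EuclideanSpace ℝ (Fin d)) :
    LambdaEmp X S k n ω l = (Real.log (∫ i : Fin (k n),
      Real.exp (inner ℝ l (S n (shift (i * n) (path X ω)))) ∂Measure.count) -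
        Real.log (k n)) / n := by
  have hk0 : (k n : ℝ) ≠ 0 := by exact_mod_cast hk.ne'
  have : Nonempty (Fin (k n)) := ⟨⟨0, hk⟩⟩
  rw [lambdaEmp_eq_log_average hn, integral_count, Finset.sum_range,
    Real.log_mul (inv_ne_zero hk0), Real.log_inv]
  · ring
  · exact (Finset.sum_pos (fun i _ => Real.exp_pos _) Finset.univ_nonempty).ne'

theorem convexOn_lambdaEmp (hn : 1 ≤ n) (hk : 0 < k n) (ω : Ω) :
    ConvexOn ℝ Set.univ (LambdaEmp X S k n ω) := by
  have : Nonempty (Fin (k n)) := ⟨⟨0, hk⟩⟩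
  have hconv := convexOn_log_integral_exp_inner (μ := (Measure.count : Measure (Fin (k n))))
    (V := fun i : Fin (k n) => S n (shift (i * n) (path X ω))) convex_univ
    fun l _ => Integrable.of_finite
  refine ((hconv.add_const (-Real.log (k n))).smul (inv_nonneg.2 n.cast_nonneg)).congr
    fun l _ => ?_
  simp only [lambdaEmp_eq_log_integral_count hn hk, smul_eq_mul, Pi.add_apply]
  ring

theorem abs_lambdaEmp_sub_lambdaEmp_le (hn : 1 ≤ n) (hk : 0 < k n) (happ : approxErr S S' n ≠ ⊤)
    (ω : Ω) (l : EuclideanSpace ℝ (Fin d)) :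
    |LambdaEmp X S k n ω l - LambdaEmp X S' k n ω l| ≤ ‖l‖ * (approxErr S S' n).toReal := by
  have : Nonempty (Fin (k n)) := ⟨⟨0, hk⟩⟩
  have hn0 : (0 : ℝ) < n := by exact_mod_cast hn
  rw [lambdaEmp_eq_log_integral_count hn hk, lambdaEmp_eq_log_integral_count hn hk, ← sub_div,
    sub_sub_sub_cancel_right, abs_div, abs_of_pos hn0, div_le_iff₀' hn0]
  exact abs_log_integral_exp_sub_le
    (fun i : Fin (k n) => abs_inner_sub_inner_le hn happ l (shift (i * n) (path X ω)))
    Integrable.of_finite Integrable.of_finite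

end Empirical

section Deviation

variable {Ω : Type*} [MeasurableSpace Ω] {E : Type*}

theorem abs_log_sub_log_le {y e t : ℝ} (he : 0 < e) (ht0 : 0 < t) (ht : t ≤ 1 / 4)
    (h : |y - e| ≤ t * e) : |Real.log y - Real.log e| ≤ t * (1 + t) := by
  obtain ⟨hlow, hupp⟩ := abs_le.1 h
  have hy : 0 < y := by nlinarith
  have hye : 0 < y / e := div_pos hy he
  rw [← Real.log_div hy.ne' he.ne', abs_le]
  constructor
  · have hseries := Real.abs_log_sub_add_sum_range_le (x := t) (by rw [abs_of_pos ht0]; linarith) 2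
    have hrem : |t| ^ (2 + 1) / (1 - |t|) ≤ t ^ 2 / 3 := by
      rw [abs_of_pos ht0, div_le_iff₀ (by linarith)]
      nlinarith [mul_nonneg (sq_nonneg t) (sub_nonneg.2 ht)]
    have hlog : Real.log (1 - t) ≤ Real.log (y / e) :=
      Real.log_le_log (by linarith) ((le_div_iff₀ he).2 (by linarith))
    norm_num [Finset.sum_range_succ] at hseries
    nlinarith [(abs_le.1 hseries).1]
  · calc Real.log (y / e) ≤ y / e - 1 := Real.log_le_sub_one_of_pos hye
      _ ≤ t := by rw [sub_le_iff_le_add, div_le_iff₀ he]; linarith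
      _ ≤ t * (1 + t) := by nlinarith

/-- The event that the average of `f` over `m` consecutive blocks of length `n` of the process is
away from the expectation of `f` by a relative error greater than `t`. -/
def deviationEvent (P : Measure Ω) (X : ℕ → Ω → E) (f : (ℕ → E) → ℝ) (n m : ℕ) (t : ℝ) : Set Ω :=
  {ω | t * ∫ ω, f (path X ω) ∂P <
    |(m : ℝ)⁻¹ * ∑ i ∈ Finset.range m, f (shift (i * n) (path X ω)) - ∫ ω, f (path X ω) ∂P|}

/-- The bound on the moments of order `1` and `1 + √ε_n` of `exp ⟨l, S_n(X)⟩` behind the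
`n`-th term of the summability condition. -/
def HasMomentBound {d : ℕ} (P : Measure Ω) (X : ℕ → Ω → E)
    (S : ℕ → (ℕ → E) → EuclideanSpace ℝ (Fin d)) (a x : ℝ) (ε δ : ℕ → ℝ) (n : ℕ)
    (l : EuclideanSpace ℝ (Fin d)) : Prop :=
  Integrable (fun ω => Real.exp (inner ℝ l (S n (path X ω)))) P ∧
  Integrable (fun ω => Real.exp (inner ℝ l (S n (path X ω))) ^ (1 + √(ε n))) P ∧
  (∫ ω, Real.exp (inner ℝ l (S n (path X ω))) ^ (1 + √(ε n)) ∂P) /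
    (∫ ω, Real.exp (inner ℝ l (S n (path X ω))) ∂P) ^ (1 + √(ε n)) ≤
    Real.exp (n * (√(ε n) * a + ε n * x + 5 / 2 * δ n))

variable {P : Measure Ω} {X : ℕ → Ω → E} {d : ℕ} {S : ℕ → (ℕ → E) → EuclideanSpace ℝ (Fin d)}
  {k : ℕ → ℕ} {ε δ : ℕ → ℝ} {a x γ θ C D : ℝ} {B : Set (EuclideanSpace ℝ (Fin d))}

theorem ae_eventually_notMem_of_summable [IsFiniteMeasure P] {A : ℕ → Set Ω} {u : ℕ → ℝ}
    (hu : Summable u) (hA : ∀ᶠ n in atTop, P.real (A n) ≤ u n) :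
    ∀ᵐ ω ∂P, ∀ᶠ n in atTop, ω ∉ A n := by
  have hsum : Summable fun n => P.real (A n) :=
    Summable.of_norm_bounded_eventually_nat hu (hA.mono fun n hA => by
      rwa [Real.norm_of_nonneg measureReal_nonneg])
  exact ae_eventually_notMem (by simpa [ofReal_measureReal] using hsum.tsum_ofReal_ne_top)

theorem ae_eventually_forall_notMem_of_summable [IsFiniteMeasure P] {α : Type*}
    {N : ℕ → Finset α} {A : ℕ → α → Set Ω} {u : ℕ → ℝ} (hu : Summable u)
    (hA : ∀ᶠ n in atTop, ∀ y ∈ N n, (N n).card * P.real (A n y) ≤ u n) :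
    ∀ᵐ ω ∂P, ∀ᶠ n in atTop, ∀ y ∈ N n, ω ∉ A n y := by
  have hunion : ∀ᶠ n in atTop, P.real (⋃ y ∈ N n, A n y) ≤ |u n| := hA.mono fun n hA => by
    refine (measureReal_biUnion_finset_le _ _).trans ?_
    rcases (N n).eq_empty_or_nonempty with hempty | hne
    · simp [hempty]
    have hcard : (0 : ℝ) < (N n).card := by exact_mod_cast hne.card_pos
    calc ∑ y ∈ N n, P.real (A n y) ≤ (N n).card • (u n / (N n).card) :=
          Finset.sum_le_card_nsmul _ _ _ fun y hy => (le_div_iff₀' hcard).2 (hA y hy)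
      _ = u n := by rw [nsmul_eq_mul, mul_div_cancel₀ _ hcard.ne']
      _ ≤ |u n| := le_abs_self _
  filter_upwards [ae_eventually_notMem_of_summable hu.abs hunion] with ω hω
  simpa only [Set.mem_iUnion, not_exists] using hω

theorem abs_lambdaEmp_sub_realLambdaN_le [NeZero P] {n : ℕ} {l : EuclideanSpace ℝ (Fin d)}
    (hn : 1 ≤ n) {t : ℝ} (ht0 : 0 < t) (ht : t ≤ 1 / 4)
    (hint : Integrable (fun ω => Real.exp (inner ℝ l (S n (path X ω)))) P) {ω : Ω}
    (hω : ω ∉ deviationEvent P X (fun z => Real.exp (inner ℝ l (S n z))) n (k n) t) :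
    |LambdaEmp X S k n ω l - realLambdaN P X S n l| ≤ t * (1 + t) / n := by
  have hn0 : (0 : ℝ) < n := by exact_mod_cast hn
  rw [lambdaEmp_eq_log_average hn, realLambdaN, ← sub_div, abs_div, abs_of_pos hn0]
  gcongr
  exact abs_log_sub_log_le (integral_exp_pos hint) ht0 ht (not_lt.1 hω)

variable [MeasurableSpace E]

theorem exists_eventually_alphaMix_le (hmix : StretchedExpMixing P X) :
    ∃ γ θ C : ℝ, 0 < γ ∧ 0 < θ ∧ 0 < C ∧
      ∀ᶠ m : ℕ in atTop, alphaMix P X m ≤ C * Real.exp (-γ * (m : ℝ) ^ θ) := by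
  obtain ⟨γ, θ, hγ, hθ, hO⟩ := hmix
  obtain ⟨C, hC, hle⟩ := hO.exists_pos
  refine ⟨γ, θ, C, hγ, hθ, hC, hle.bound.mono fun m hm => ?_⟩
  rw [Real.norm_eq_abs, Real.norm_eq_abs, Real.abs_exp] at hm
  exact (le_abs_self _).trans hm

variable [IsProbabilityMeasure P]

theorem measureReal_deviationEvent_le (hX : ∀ i, Measurable (X i)) (hstat : Stationary P X)
    {f : (ℕ → E) → ℝ} (hf : Measurable f) (hf0 : ∀ z, 0 ≤ f z) {n : ℕ}
    (hdep : DependsOn f (Set.Iio (2 * n))) {m q : ℕ} (hm : 0 < m) (hq : 2 ≤ q) {τ t : ℝ}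
    (hτ : 0 < τ) (hτ1 : τ ≤ 1) (ht : 0 < t) (hint : Integrable (fun ω => f (path X ω)) P)
    (hpos : 0 < ∫ ω, f (path X ω) ∂P) (hp : Integrable (fun ω => f (path X ω) ^ (1 + τ)) P) :
    P.real (deviationEvent P X f n m t) ≤
      21 * ((q / m : ℝ) ^ τ * t ^ (-(1 + τ)) *
        ((∫ ω, f (path X ω) ^ (1 + τ) ∂P) / (∫ ω, f (path X ω) ∂P) ^ (1 + τ))) +
      9 * (alphaMix P X ((q - 2) * n + 1) * m ^ 2 / q ^ 2) := by
  have hzero : (fun ω => f (shift (0 * n) (path X ω))) = fun ω => f (path X ω) := by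
    simp only [zero_mul]
    rfl
  have hdev := measureReal_abs_average_sub_gt_le (P := P)
    (Y := fun i ω => f (shift (i * n) (path X ω)))
    (fun i => hf.comp ((measurable_shift _).comp (measurable_path hX))) (fun i ω => hf0 _)
    (fun i => by simpa only [hzero] using identDistrib_comp_shift_path hf hX hstat (i * n))
    (τ := τ) (k := m) (q := q) (ε := t) (a := alphaMix P X ((q - 2) * n + 1))
  simp only [congrFun hzero] at hdev
  exact hdev hint hpos hτ hτ1 hp hm (by omega) ht fun i j hij =>
    alphaCoeff_block_le_alphaMix hf hdep hq hij

theorem eventually_mul_measureReal_deviationEvent_le (hX : ∀ i, Measurable (X i))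
    (hstat : Stationary P X) (hS : ∀ n, 1 ≤ n → Measurable (S n))
    (hdep : ∀ n, 1 ≤ n → DependsOn (S n) (Set.Iio (2 * n))) (hk : ∀ n, 1 ≤ n → 0 < k n)
    (hεpos : ∀ n, 1 ≤ n → 0 < ε n) (hε : Tendsto ε atTop (𝓝 0)) (hγ : 0 < γ)
    (hC : 0 < C)
    (hα : ∀ᶠ m : ℕ in atTop, alphaMix P X m ≤ C * Real.exp (-γ * (m : ℝ) ^ θ))
    (hmom : ∀ᶠ n in atTop, ∀ l ∈ B, HasMomentBound P X S a x ε δ n l) :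
    ∀ᶠ n : ℕ in atTop, ∀ l ∈ B, ε n ^ (-(D + 1 / 4)) *
        P.real (deviationEvent P X (fun z => Real.exp (inner ℝ l (S n z))) n (k n) (ε n)) ≤
      21 * momentTerm D a x (fun n => mixingGap γ θ (Real.log (k n)) n) k ε δ n +
      9 * C * (ε n ^ (-(D + 1 / 4)) * (Real.exp (-γ *
        (((mixingGap γ θ (Real.log (k n)) n - 2) * n + 1 : ℕ) : ℝ) ^ θ) * (k n : ℝ) ^ 2)) := by
  filter_upwards [hmom, eventually_forall_ge_atTop.2 hα, hε.eventually_le_const one_pos,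
    eventually_ge_atTop 2] with n hmom hα hε1 hn l hl
  obtain ⟨hint, hintp, hratio⟩ := hmom l hl
  have hn1 : 1 ≤ n := by omega
  have hε0 := hεpos n hn1
  rw [momentTerm]
  set q := mixingGap γ θ (Real.log (k n)) n
  have hq : 3 ≤ q := three_le_mixingGap hγ (Real.log_natCast_nonneg _) hn
  have hgap : n ≤ (q - 2) * n + 1 :=
    (Nat.le_mul_of_pos_left n (by omega)).trans (Nat.le_succ _)
  have hmix : alphaMix P X ((q - 2) * n + 1) * (k n : ℝ) ^ 2 / (q : ℝ) ^ 2 ≤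
      C * (Real.exp (-γ * (((q - 2) * n + 1 : ℕ) : ℝ) ^ θ) * (k n : ℝ) ^ 2) := by
    rw [← mul_assoc]
    refine (div_le_div_of_nonneg_right
      (mul_le_mul_of_nonneg_right (hα _ hgap) (by positivity)) (by positivity)).trans ?_
    exact div_le_self (by positivity) (one_le_pow₀ (by exact_mod_cast (by omega : 1 ≤ q)))
  have hdev := measureReal_deviationEvent_le hX hstat (hS n hn1).const_inner.exp
    (fun z => (Real.exp_pos _).le)
    (fun y z hyz => congrArg (fun v => Real.exp (inner ℝ l v)) (hdep n hn1 hyz)) (hk n hn1)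
    (by omega : 2 ≤ q) (Real.sqrt_pos.2 hε0) (Real.sqrt_le_one.2 hε1) hε0 hint
    (integral_exp_pos hint) hintp
  calc _ ≤ ε n ^ (-(D + 1 / 4)) * (21 * ((q / k n : ℝ) ^ √(ε n) * ε n ^ (-(1 + √(ε n))) *
          Real.exp (n * (√(ε n) * a + ε n * x + 5 / 2 * δ n))) +
        9 * (C * (Real.exp (-γ * (((q - 2) * n + 1 : ℕ) : ℝ) ^ θ) * (k n : ℝ) ^ 2))) := by
        gcongr ?_ * ?_
        refine hdev.trans ?_
        gcongr
    _ = _ := by ring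

theorem ae_eventually_abs_lambdaEmp_sub_le (hX : ∀ i, Measurable (X i)) (hstat : Stationary P X)
    (hmix : StretchedExpMixing P X) (hS : ∀ n, 1 ≤ n → Measurable (S n))
    (hdep : ∀ n, 1 ≤ n → DependsOn (S n) (Set.Iio (2 * n))) (hk : ∀ n, 1 ≤ n → 0 < k n)
    (hεpos : ∀ n, 1 ≤ n → 0 < ε n) (hε : Tendsto ε atTop (𝓝 0)) (hD : 0 ≤ D) (ha : 0 ≤ a)
    (hax : a ≤ x) (hδ : ∀ n, 0 ≤ δ n) (hsum : Summable (realBcTerm D a x k ε δ))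
    (hmom : ∀ᶠ n in atTop, ∀ l ∈ B, HasMomentBound P X S a x ε δ n l)
    (hC : 0 ≤ C) {N : ℕ → Finset (EuclideanSpace ℝ (Fin d))}
    (hNB : ∀ n, ↑(N n) ⊆ B) (hN : ∀ᶠ n in atTop, ((N n).card : ℝ) ≤ C * ε n ^ (-(D + 1 / 4))) :
    ∀ᵐ ω ∂P, ∀ᶠ n in atTop, ∀ l ∈ N n,
      |LambdaEmp X S k n ω l - realLambdaN P X S n l| ≤ ε n * (1 + ε n) / n := by
  obtain ⟨γ, θ, Cα, hγ, hθ, hCα, hα⟩ := exists_eventually_alphaMix_le hmix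
  have hsmall : ∀ᶠ n in atTop, ε n ≤ 1 / 4 := hε.eventually_le_const (by norm_num)
  have hsum_moment := summable_momentTerm hγ hθ hD ha hax hk hεpos hε hδ hsum
  have hsum_mixing := summable_mixing_term hγ hθ hk hεpos hε
    (eventually_mul_neg_log_le_log ha (ha.trans hax) hεpos hε hδ hsum)
  have hdev := ae_eventually_forall_notMem_of_summable (P := P) (N := N)
    (A := fun n l => deviationEvent P X (fun z => Real.exp (inner ℝ l (S n z))) n (k n) (ε n))
    (((hsum_moment.mul_left 21).add (hsum_mixing.mul_left (9 * Cα))).mul_left C) (by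
      filter_upwards [hN, eventually_mul_measureReal_deviationEvent_le (D := D) hX hstat hS hdep hk
        hεpos hε hγ hCα hα hmom] with n hN hle l hl
      refine (mul_le_mul_of_nonneg_right hN measureReal_nonneg).trans ?_
      rw [mul_assoc]
      exact mul_le_mul_of_nonneg_left (hle l (hNB n hl)) hC)
  filter_upwards [hdev] with ω hω
  filter_upwards [hω, hmom, hsmall, eventually_ge_atTop 1] with n hω hmom hsmall hn l hl
  exact abs_lambdaEmp_sub_realLambdaN_le hn (hεpos n hn) hsmall (hmom l (hNB n hl)).1 (hω l hl)

end Deviation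

section EquiLipschitz

variable {F : Type*} [NormedAddCommGroup F] [NormedSpace ℝ F]

theorem exists_finset_lipschitzOnWith_ball [FiniteDimensional ℝ F] (x₀ : F) {ρ : ℝ} (hρ : 0 < ρ) :
    ∃ T : Finset F, ↑T ⊆ Metric.ball x₀ ρ ∧ ∃ r : ℝ, 0 < r ∧ ∀ M : ℝ, ∃ C : NNReal,
      ∀ h : F → ℝ, ConvexOn ℝ (Metric.ball x₀ ρ) h → (∀ t ∈ T, h t ≤ M) → -M ≤ h x₀ →
        LipschitzOnWith C h (Metric.ball x₀ r) := by
  obtain ⟨b, hx₀, hb⟩ := exists_mem_interior_convexHull_affineBasis (Metric.ball_mem_nhds x₀ hρ)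
  obtain ⟨r, hr, hrb⟩ := Metric.mem_nhds_iff.1 (mem_interior_iff_mem_nhds.1 hx₀)
  have hbρ : Set.range b ⊆ Metric.ball x₀ ρ := (subset_convexHull ℝ _).trans hb
  classical
  refine ⟨Finset.univ.image b, by simpa using hbρ, r / 2, by positivity, fun M => ⟨_,
    fun h hconv hM hm => lipschitzOnWith_ball_of_convexOn hr
      (hconv.subset (hrb.trans hb) (convex_ball _ _)) (M := M) (fun x hx => ?_) hm⟩⟩
  obtain ⟨_, ⟨i, rfl⟩, hle⟩ := hconv.exists_ge_of_mem_convexHull hbρ (hrb hx)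
  exact hle.trans (hM _ (Finset.mem_image_of_mem b (Finset.mem_univ i)))

-- A convex function is controlled on a simplex by its values at the vertices.
theorem exists_finset_abs_sub_le_mul_dist [FiniteDimensional ℝ F] {B : Set F} (hB : IsCompact B)
    {ρ : ℝ} (hρ : 0 < ρ) :
    ∃ T T₀ : Finset F, ↑T ⊆ Metric.thickening ρ B ∧ ↑T₀ ⊆ B ∧ ∃ s : ℝ, 0 < s ∧
      ∀ M : ℝ, ∃ C : NNReal, ∀ h : F → ℝ, (∀ x ∈ B, ConvexOn ℝ (Metric.ball x ρ) h) →
        (∀ t ∈ T, h t ≤ M) → (∀ t ∈ T₀, -M ≤ h t) →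
        ∀ x ∈ B, ∀ y, dist x y < s → |h x - h y| ≤ C * dist x y := by
  choose! T hT r hr C hC using fun x₀ : F => exists_finset_lipschitzOnWith_ball x₀ hρ
  obtain ⟨t, htB, hcover⟩ := hB.elim_nhds_subcover (fun x => Metric.ball x (r x / 2))
    fun x _ => Metric.ball_mem_nhds x (half_pos (hr x))
  classical
  refine ⟨t.biUnion T, t, ?_, htB, ?_⟩
  · rw [Finset.coe_biUnion, Metric.thickening_eq_biUnion_ball]
    exact Set.biUnion_mono htB fun x _ => hT x
  rcases t.eq_empty_or_nonempty with rfl | hne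
  · exact ⟨1, one_pos, fun M => ⟨0, fun h _ _ _ x hx => by simpa using hcover hx⟩⟩
  refine ⟨t.inf' hne (fun x => r x / 2), (Finset.lt_inf'_iff _).2 fun x _ => half_pos (hr x),
    fun M => ⟨t.sup fun x => C x M, fun h hconv hM hm x hx y hxy => ?_⟩⟩
  obtain ⟨x₀, hx₀, hx⟩ := Set.mem_iUnion₂.1 (hcover hx)
  rw [Metric.mem_ball] at hx
  have hys : dist y x < r x₀ / 2 := by
    rw [dist_comm]
    exact hxy.trans_le (Finset.inf'_le _ hx₀)
  have hlip := hC x₀ M h (hconv x₀ (htB x₀ hx₀))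
    (fun t ht => hM t (Finset.mem_biUnion.2 ⟨x₀, hx₀, ht⟩)) (hm x₀ hx₀)
  have hdist := hlip.dist_le_mul x (Metric.mem_ball.2 (by linarith [hr x₀])) y
    (Metric.mem_ball.2 (by linarith [dist_triangle y x x₀]))
  rw [Real.dist_eq] at hdist
  refine hdist.trans ?_
  gcongr
  exact Finset.le_sup (f := fun x => C x M) hx₀

end EquiLipschitz

section Uniform

variable {Ω : Type*} [MeasurableSpace Ω] {E : Type*} [MeasurableSpace E] {P : Measure Ω}
  {X : ℕ → Ω → E}

theorem measureReal_le_block_average_le [IsFiniteMeasure P] (hX : ∀ i, Measurable (X i))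
    (hstat : Stationary P X) {f : (ℕ → E) → ℝ} (hf : Measurable f) (hf0 : ∀ z, 0 ≤ f z)
    (hint : Integrable (fun ω => f (path X ω)) P) (hpos : 0 < ∫ ω, f (path X ω) ∂P) {c : ℝ}
    (hc : 0 < c) (n : ℕ) {m : ℕ} (hm : 0 < m) :
    P.real {ω | c * ∫ ω, f (path X ω) ∂P ≤
      (m : ℝ)⁻¹ * ∑ i ∈ Finset.range m, f (shift (i * n) (path X ω))} ≤ c⁻¹ := by
  have hid (i : ℕ) := identDistrib_comp_shift_path hf hX hstat (i * n)
  have hinti (i : ℕ) : Integrable (fun ω => f (shift (i * n) (path X ω))) P :=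
    (hid i).integrable_iff.2 hint
  have hm0 : (m : ℝ) ≠ 0 := by exact_mod_cast hm.ne'
  have haverage : ∫ ω, (m : ℝ)⁻¹ * ∑ i ∈ Finset.range m, f (shift (i * n) (path X ω)) ∂P =
      ∫ ω, f (path X ω) ∂P := by
    rw [integral_const_mul, integral_finsetSum _ fun i _ => hinti i,
      Finset.sum_congr rfl fun i _ => (hid i).integral_eq, Finset.sum_const, Finset.card_range,
      nsmul_eq_mul, inv_mul_cancel_left₀ hm0]
  have hmarkov := mul_meas_ge_le_integral_of_nonneg (μ := P)
    (ae_of_all _ fun ω => mul_nonneg (inv_nonneg.2 m.cast_nonneg)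
      (Finset.sum_nonneg fun i _ => hf0 (shift (i * n) (path X ω))))
    ((integrable_finsetSum (Finset.range m) fun i _ => hinti i).const_mul _)
    (c * ∫ ω, f (path X ω) ∂P)
  rw [haverage, mul_right_comm] at hmarkov
  rw [← one_div c]
  exact (le_div_iff₀' hc).2 ((mul_le_iff_le_one_left hpos).1 hmarkov)

variable [IsProbabilityMeasure P] {d : ℕ} {S : ℕ → (ℕ → E) → EuclideanSpace ℝ (Fin d)} {k : ℕ → ℕ}
  {B : Set (EuclideanSpace ℝ (Fin d))}

theorem ae_eventually_lambdaEmp_le (hX : ∀ i, Measurable (X i)) (hstat : Stationary P X)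
    (hS : ∀ n, 1 ≤ n → Measurable (S n)) (hk : ∀ n, 1 ≤ n → 0 < k n)
    {l : EuclideanSpace ℝ (Fin d)}
    (hint : ∀ᶠ n in atTop, Integrable (fun ω => Real.exp (inner ℝ l (S n (path X ω)))) P) :
    ∀ᵐ ω ∂P, ∀ᶠ n in atTop, LambdaEmp X S k n ω l ≤ realLambdaN P X S n l + 1 := by
  have hmarkov : ∀ᶠ n : ℕ in atTop, P.real {ω | Real.exp n *
      ∫ ω, Real.exp (inner ℝ l (S n (path X ω))) ∂P ≤ (k n : ℝ)⁻¹ *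
        ∑ i ∈ Finset.range (k n), Real.exp (inner ℝ l (S n (shift (i * n) (path X ω))))} ≤
      Real.exp (-n) := by
    filter_upwards [hint, eventually_ge_atTop 1] with n hint hn
    rw [Real.exp_neg]
    exact measureReal_le_block_average_le hX hstat
      (f := fun z => Real.exp (inner ℝ l (S n z))) (hS n hn).const_inner.exp
      (fun z => (Real.exp_pos _).le) hint (integral_exp_pos hint) (Real.exp_pos _) n (hk n hn)
  filter_upwards [ae_eventually_notMem_of_summable Real.summable_exp_neg_nat hmarkov] with ω hω
  filter_upwards [hω, hint, eventually_ge_atTop 1] with n hω hint hn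
  have hn0 : (0 : ℝ) < n := by exact_mod_cast hn
  have haverage : 0 < (k n : ℝ)⁻¹ * ∑ i ∈ Finset.range (k n),
      Real.exp (inner ℝ l (S n (shift (i * n) (path X ω)))) :=
    mul_pos (inv_pos.2 (by exact_mod_cast hk n hn))
      (Finset.sum_pos (fun i _ => Real.exp_pos _) ⟨0, Finset.mem_range.2 (hk n hn)⟩)
  have hlog := Real.log_le_log haverage (not_le.1 hω).le
  rw [Real.log_mul (Real.exp_pos _).ne' (integral_exp_pos hint).ne', Real.log_exp] at hlog
  rw [lambdaEmp_eq_log_average hn, realLambdaN, div_add_one hn0.ne']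
  gcongr
  linarith

theorem exists_ae_eventually_abs_sub_le_mul_dist (hX : ∀ i, Measurable (X i))
    (hstat : Stationary P X) (hS : ∀ n, 1 ≤ n → Measurable (S n)) (hk : ∀ n, 1 ≤ n → 0 < k n)
    (hB : IsCompact B) {ρ : ℝ} (hρ : 0 < ρ) {Λ : EuclideanSpace ℝ (Fin d) → ℝ}
    (hint : ∀ᶠ n in atTop, ∀ l ∈ Metric.thickening ρ B,
      Integrable (fun ω => Real.exp (inner ℝ l (S n (path X ω)))) P)
    (hlim : ∀ l ∈ Metric.thickening ρ B, Tendsto (fun n => realLambdaN P X S n l) atTop (𝓝 (Λ l)))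
    (hpoint : ∀ l ∈ B, ∀ᵐ ω ∂P, ∀ᶠ n in atTop,
      |LambdaEmp X S k n ω l - realLambdaN P X S n l| ≤ 1) :
    ∃ s : ℝ, 0 < s ∧ ∃ C : NNReal, ∀ᵐ ω ∂P, ∀ᶠ n in atTop, ∀ x ∈ B, ∀ y, dist x y < s →
      |LambdaEmp X S k n ω x - LambdaEmp X S k n ω y| ≤ C * dist x y ∧
      |realLambdaN P X S n x - realLambdaN P X S n y| ≤ C * dist x y := by
  obtain ⟨T, T₀, hT, hT₀, s, hs, hlip⟩ := exists_finset_abs_sub_le_mul_dist hB hρ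
  have hBρ : B ⊆ Metric.thickening ρ B := Metric.self_subset_thickening hρ B
  classical
  obtain ⟨M, hM⟩ := ((T ∪ T₀).finite_toSet.image fun l => |Λ l|).bddAbove
  have hMΛ : ∀ l ∈ T ∪ T₀, |Λ l| ≤ M := fun l hl => hM (Set.mem_image_of_mem _ hl)
  obtain ⟨C, hC⟩ := hlip (M + 2)
  have hnear : ∀ l ∈ T ∪ T₀, ∀ᶠ n in atTop, |realLambdaN P X S n l| ≤ M + 1 := fun l hl => by
    have hlT : l ∈ Metric.thickening ρ B :=
      (Finset.mem_union.1 hl).elim (fun h => hT h) fun h => hBρ (hT₀ h)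
    exact (hlim l hlT).abs.eventually_le_const (by linarith [hMΛ l hl])
  have hupper : ∀ᵐ ω ∂P, ∀ l ∈ T, ∀ᶠ n in atTop,
      LambdaEmp X S k n ω l ≤ realLambdaN P X S n l + 1 := (Finset.eventually_all T).2
    fun l hl => ae_eventually_lambdaEmp_le hX hstat hS hk (hint.mono fun n hn => hn l (hT hl))
  have hlower := (Finset.eventually_all T₀).2 fun l hl => hpoint l (hT₀ hl)
  refine ⟨s, hs, C, ?_⟩
  filter_upwards [hupper, hlower] with ω hupper hlower
  filter_upwards [(Finset.eventually_all _).2 hnear, (Finset.eventually_all T).2 hupper,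
    (Finset.eventually_all T₀).2 hlower, hint, eventually_ge_atTop 1]
    with n hnear hupper hlower hint hn x hx y hxy
  have hball : ∀ z ∈ B, Metric.ball z ρ ⊆ Metric.thickening ρ B := fun z hz =>
    Metric.ball_subset_thickening hz ρ
  refine ⟨hC _ (fun z _ => ?_) (fun t ht => ?_) (fun t ht => ?_) x hx y hxy,
    hC _ (fun z hz => ?_) (fun t ht => ?_) (fun t ht => ?_) x hx y hxy⟩
  · exact (convexOn_lambdaEmp hn (hk n hn) ω).subset (Set.subset_univ _) (convex_ball _ _)
  · linarith [hupper t ht, (abs_le.1 (hnear t (Finset.mem_union_left _ ht))).2]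
  · linarith [(abs_le.1 (hlower t ht)).1, (abs_le.1 (hnear t (Finset.mem_union_right _ ht))).1]
  · exact convexOn_realLambdaN (convex_ball _ _) fun l hl => hint l (hball z hz hl)
  · linarith [(abs_le.1 (hnear t (Finset.mem_union_left _ ht))).2]
  · linarith [(abs_le.1 (hnear t (Finset.mem_union_right _ ht))).1]

end Uniform

section Nets

variable {F : Type*} [NormedAddCommGroup F] [NormedSpace ℝ F] [FiniteDimensional ℝ F]

theorem exists_finset_nets {B : Set F} (hB : Bornology.IsBounded B) {ε : ℕ → ℝ}
    (hεpos : ∀ n, 1 ≤ n → 0 < ε n) (hε : Tendsto ε atTop (𝓝 0)) :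
    ∃ C β : ℝ, 0 ≤ C ∧ 0 < β ∧ ∃ N : ℕ → Finset F, (∀ n, ↑(N n) ⊆ B) ∧ ∀ᶠ n in atTop,
      ((N n).card : ℝ) ≤ C * ε n ^ (-((Module.finrank ℝ F : ℝ) + 1 / 4)) ∧
      ∀ x ∈ B, ∃ y ∈ N n, dist x y ≤ ε n * ε n ^ β := by
  obtain ⟨C, hC, hnet⟩ := exists_finset_net hB
  set D : ℝ := (Module.finrank ℝ F : ℝ)
  have _ : 0 ≤ D := Nat.cast_nonneg _
  have hβ : 0 < 1 / (4 * (D + 1)) := by positivity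
  have hDβ : D * (1 + 1 / (4 * (D + 1))) ≤ D + 1 / 4 := by
    rw [mul_one_add]
    gcongr
    rw [mul_one_div, div_le_div_iff₀ (by positivity) (by norm_num)]
    linarith
  have hr (t : ℝ) (ht : 0 < t ∧ t ≤ 1) : ∃ N : Finset F, ↑N ⊆ B ∧
      (N.card : ℝ) ≤ C * t ^ (-(D + 1 / 4)) ∧
      ∀ x ∈ B, ∃ y ∈ N, dist x y ≤ t * t ^ (1 / (4 * (D + 1))) := by
    obtain ⟨N, hNB, hcard, hN⟩ := hnet (t ^ (1 + 1 / (4 * (D + 1)))) (Real.rpow_pos_of_pos ht.1 _)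
      (Real.rpow_le_one ht.1.le ht.2 (by positivity))
    rw [Real.rpow_one_add' ht.1.le (by positivity)] at hN
    refine ⟨N, hNB, hcard.trans ?_, hN⟩
    rw [← Real.rpow_mul ht.1.le]
    gcongr ?_ * ?_
    exact Real.rpow_le_rpow_of_exponent_ge ht.1 ht.2 (by linarith)
  have hex (n : ℕ) : ∃ N : Finset F, ↑N ⊆ B ∧ (0 < ε n ∧ ε n ≤ 1 →
      (N.card : ℝ) ≤ C * ε n ^ (-(D + 1 / 4)) ∧
      ∀ x ∈ B, ∃ y ∈ N, dist x y ≤ ε n * ε n ^ (1 / (4 * (D + 1)))) := by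
    by_cases hεn : 0 < ε n ∧ ε n ≤ 1
    · obtain ⟨N, hNB, hN⟩ := hr (ε n) hεn
      exact ⟨N, hNB, fun _ => hN⟩
    · exact ⟨∅, by simp, fun h => absurd h hεn⟩
  choose N hNB hN using hex
  refine ⟨C, _, hC.le, hβ, N, hNB, ?_⟩
  filter_upwards [hε.eventually_le_const one_pos, eventually_ge_atTop 1] with n hεn hn
  exact hN n ⟨hεpos n hn, hεn⟩

theorem eventually_forall_abs_sub_le_mul {F : Type*} [PseudoMetricSpace F] {B : Set F}
    {f g : ℕ → F → ℝ} {N : ℕ → Finset F} {ε : ℕ → ℝ} {C s β η : ℝ}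
    (hεpos : ∀ n, 1 ≤ n → 0 < ε n) (hε : Tendsto ε atTop (𝓝 0)) (hs : 0 < s) (hC : 0 ≤ C)
    (hβ : 0 < β) (hη : 0 < η)
    (hnet : ∀ᶠ n in atTop, ∀ x ∈ B, ∃ y ∈ N n, dist x y ≤ ε n * ε n ^ β)
    (hfg : ∀ᶠ n in atTop, ∀ y ∈ N n, |f n y - g n y| ≤ ε n * (1 + ε n) / n)
    (hlip : ∀ᶠ n in atTop, ∀ x ∈ B, ∀ y, dist x y < s →
      |f n x - f n y| ≤ C * dist x y ∧ |g n x - g n y| ≤ C * dist x y) :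
    ∀ᶠ n in atTop, ∀ x ∈ B, |f n x - g n x| ≤ η * ε n := by
  have hεβ : Tendsto (fun n => ε n ^ β) atTop (𝓝 0) := by
    simpa [Real.zero_rpow hβ.ne'] using hε.rpow_const (p := β) (Or.inr hβ.le)
  have hmesh : Tendsto (fun n => ε n * ε n ^ β) atTop (𝓝 0) := by simpa using hε.mul hεβ
  have herror : Tendsto (fun n : ℕ => 2 * C * ε n ^ β + (1 + ε n) / n) atTop (𝓝 0) := by
    simpa using (hεβ.const_mul (2 * C)).add
      ((hε.const_add 1).div_atTop tendsto_natCast_atTop_atTop)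
  filter_upwards [hnet, hfg, hlip, hmesh.eventually_lt_const hs, herror.eventually_le_const hη,
    eventually_ge_atTop 1] with n hnet hfg hlip hmesh herror hn x hx
  obtain ⟨y, hy, hxy⟩ := hnet x hx
  obtain ⟨hf, hg⟩ := hlip x hx y (hxy.trans_lt hmesh)
  calc |f n x - g n x|
      ≤ |f n x - f n y| + |f n y - g n y| + |g n x - g n y| := by
        rw [abs_sub_comm (g n x)]
        exact (abs_sub_le _ (g n y) _).trans (add_le_add_left (abs_sub_le _ _ _) _)
    _ ≤ C * (ε n * ε n ^ β) + ε n * (1 + ε n) / n + C * (ε n * ε n ^ β) := by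
        have hCxy := mul_le_mul_of_nonneg_left hxy hC
        exact add_le_add (add_le_add (hf.trans hCxy) (hfg y hy)) (hg.trans hCxy)
    _ = (2 * C * ε n ^ β + (1 + ε n) / n) * ε n := by ring
    _ ≤ η * ε n := mul_le_mul_of_nonneg_right herror (hεpos n hn).le

end Nets

section NetEstimate

variable {Ω : Type*} [MeasurableSpace Ω] {E : Type*} {d : ℕ} {P : Measure Ω} {X : ℕ → Ω → E}
  {S S' : ℕ → (ℕ → E) → EuclideanSpace ℝ (Fin d)} {A B D : Set (EuclideanSpace ℝ (Fin d))}
  {l : EuclideanSpace ℝ (Fin d)} {k : ℕ → ℕ} {ε : ℕ → ℝ} {n : ℕ}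

/-- Almost surely, the empirical `Λ_n^ω` is eventually within `ε_n (1 + ε_n) / n` of `Λ_n` on any
given finite subsets `N_n` of `B` whose cardinality is `O(ε_n^{-(d + 1/4)})`. -/
def HasNetEstimate (P : Measure Ω) (X : ℕ → Ω → E)
    (S : ℕ → (ℕ → E) → EuclideanSpace ℝ (Fin d)) (k : ℕ → ℕ) (ε : ℕ → ℝ)
    (B : Set (EuclideanSpace ℝ (Fin d))) : Prop :=
  ∀ (C : ℝ) (N : ℕ → Finset (EuclideanSpace ℝ (Fin d))), 0 ≤ C → (∀ n, ↑(N n) ⊆ B) →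
    (∀ᶠ n in atTop, ((N n).card : ℝ) ≤ C * ε n ^ (-((d : ℝ) + 1 / 4))) →
    ∀ᵐ ω ∂P, ∀ᶠ n in atTop, ∀ l ∈ N n,
      |LambdaEmp X S k n ω l - realLambdaN P X S n l| ≤ ε n * (1 + ε n) / n

theorem HasNetEstimate.ae_eventually_abs_sub_le (hnet : HasNetEstimate P X S k ε B)
    (hεpos : ∀ n, 1 ≤ n → 0 < ε n) (hε : Tendsto ε atTop (𝓝 0)) (hl : l ∈ B) :
    ∀ᵐ ω ∂P, ∀ᶠ n in atTop,
      |LambdaEmp X S k n ω l - realLambdaN P X S n l| ≤ ε n * (1 + ε n) / n := by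
  have hcard : ∀ᶠ n in atTop, ((({l} : Finset (EuclideanSpace ℝ (Fin d))).card : ℕ) : ℝ) ≤
      1 * ε n ^ (-((d : ℝ) + 1 / 4)) := by
    filter_upwards [hε.eventually_le_const one_pos, eventually_ge_atTop 1] with n hεn hn
    rw [Finset.card_singleton, Nat.cast_one, one_mul]
    exact Real.one_le_rpow_of_pos_of_le_one_of_nonpos (hεpos n hn) hεn
      (neg_nonpos.2 (by positivity))
  simpa using hnet 1 (fun _ => {l}) zero_le_one (fun _ => by simpa using hl) hcard

theorem ofReal_abs_lambdaEmp_sub_lambdaReal_le [NeZero P] [MeasurableSpace E]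
    (hX : ∀ i, Measurable (X i)) (hn : 1 ≤ n) (hk : 0 < k n) (hS : Measurable (S n))
    (hS' : Measurable (S' n)) (hlim : HasFiniteLimitOn P X S D) (hAD : A ⊆ D) (hBA : B ⊆ A)
    (hB : Bornology.IsBounded B) (happ : approxErr S S' n ≠ ⊤) (hl : l ∈ B) {ω : Ω} {c : ℝ}
    (hc : |LambdaEmp X S' k n ω l - realLambdaN P X S' n l| ≤ c) :
    ENNReal.ofReal |LambdaEmp X S k n ω l - LambdaReal P X S l| ≤
      ENNReal.ofReal c + deltaLambda P X S A n + 2 * deltaPhi S S' B n := by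
  by_cases hδ : deltaLambda P X S A n = ⊤
  · simp [hδ]
  have hΦ := norm_mul_approxErr_le hB happ hl
  have hemp := (abs_lambdaEmp_sub_lambdaEmp_le (X := X) hn hk happ ω l).trans hΦ
  have hpressure := (abs_realLambdaN_sub_realLambdaN_le hX hn hS' happ
    (integrable_of_deltaLambda_ne_top hX hn hS hlim hAD (hBA hl) hδ)).trans hΦ
  have hΛ := abs_lambdaReal_sub_realLambdaN_le hX hn hS hlim hAD (hBA hl) hδ
  have hle : |LambdaEmp X S k n ω l - LambdaReal P X S l| ≤
      c + (deltaLambda P X S A n).toReal + 2 * (deltaPhi S S' B n).toReal := by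
    rw [abs_le] at *
    constructor <;> linarith
  rw [← ENNReal.ofReal_toReal hδ, ← ENNReal.ofReal_toReal (deltaPhi_ne_top hB happ),
    ← ENNReal.ofReal_ofNat 2, ← ENNReal.ofReal_mul zero_le_two]
  exact (ENNReal.ofReal_le_ofReal hle).trans
    (ENNReal.ofReal_add_le.trans (add_le_add_left ENNReal.ofReal_add_le _))

variable [MeasurableSpace E]

theorem eventually_approxErr_ne_top (happ : LocalApprox S S') :
    ∀ᶠ n in atTop, approxErr S S' n ≠ ⊤ :=
  happ.2.eventually_ne ENNReal.zero_ne_top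

theorem eventually_forall_integrable_exp (hX : ∀ i, Measurable (X i))
    (hS : ∀ n, 1 ≤ n → Measurable (S n)) (happ : LocalApprox S S')
    (hlim : HasFiniteLimitOn P X S D) (hAD : A ⊆ D)
    (hδ : ∀ n, 1 ≤ n → deltaTot P X S S' A n ≠ ⊤) :
    ∀ᶠ n in atTop, ∀ l ∈ A, Integrable (fun ω => Real.exp (inner ℝ l (S' n (path X ω)))) P := by
  filter_upwards [eventually_approxErr_ne_top happ, eventually_ge_atTop 1] with n htop hn l hl
  exact integrable_of_deltaTot_ne_top hX hn (hS n hn) (happ.1 n hn).1 hlim hAD hl htop (hδ n hn)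

theorem tendsto_realLambdaN_of_localApprox [NeZero P] (hX : ∀ i, Measurable (X i))
    (hS : ∀ n, 1 ≤ n → Measurable (S n)) (happ : LocalApprox S S')
    (hlim : HasFiniteLimitOn P X S D) (hl : l ∈ D) :
    Tendsto (fun n => realLambdaN P X S' n l) atTop (𝓝 (LambdaReal P X S l)) := by
  have herror : Tendsto (fun n => ‖l‖ * (approxErr S S' n).toReal) atTop (𝓝 0) := by
    simpa using ((ENNReal.tendsto_toReal ENNReal.zero_ne_top).comp happ.2).const_mul ‖l‖
  have hdiff : Tendsto (fun n => realLambdaN P X S n l - realLambdaN P X S' n l) atTop (𝓝 0) := by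
    refine squeeze_zero_norm' ?_ herror
    filter_upwards [eventually_approxErr_ne_top happ, eventually_integrable_exp hX hS hlim hl,
      eventually_ge_atTop 1] with n htop hint hn
    exact abs_realLambdaN_sub_realLambdaN_le hX hn (happ.1 n hn).1 htop hint
  simpa using (tendsto_realLambdaN hX hS hlim hl).sub hdiff

theorem eventually_hasMomentBound [NeZero P] (hX : ∀ i, Measurable (X i))
    (hS : ∀ n, 1 ≤ n → Measurable (S n)) (happ : LocalApprox S S')
    (hlim : HasFiniteLimitOn P X S D) (hC2 : ContDiffOn ℝ 2 (LambdaReal P X S) D)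
    (hB : Bornology.IsBounded B) {ρ : ℝ} (hρ : 0 < ρ) (hBρ : Metric.cthickening ρ B ⊆ D)
    (hεpos : ∀ n, 1 ≤ n → 0 < ε n) (hε : Tendsto ε atTop (𝓝 0)) {a x : ℝ} (hx0 : 0 ≤ x)
    (ha : ∀ l ∈ B, fderiv ℝ (LambdaReal P X S) l l - LambdaReal P X S l ≤ a)
    (hx : ∀ l ∈ Metric.cthickening ρ B,
      1 / 2 * fderiv ℝ (fderiv ℝ (LambdaReal P X S)) l l l ≤ x)
    (hδ : ∀ n, 1 ≤ n → deltaTot P X S S' (Metric.cthickening ρ B) n ≠ ⊤) :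
    ∀ᶠ n in atTop, ∀ l ∈ B, HasMomentBound P X S' a x ε
      (fun n => (deltaTot P X S S' (Metric.cthickening ρ B) n).toReal) n l := by
  obtain ⟨R, hR, hBR⟩ := hB.exists_pos_norm_le
  have hsqrt : Tendsto (fun n => √(ε n)) atTop (𝓝 0) := by simpa using hε.sqrt
  filter_upwards [eventually_approxErr_ne_top happ, hsqrt.eventually_le_const (u := 1 / 4)
    (by norm_num), hsqrt.eventually_le_const (div_pos hρ hR), eventually_ge_atTop 1]
    with n htop hquarter hradius hn l hl
  have hseg : ∀ t ∈ Set.Icc 0 √(ε n), l + t • l ∈ Metric.cthickening ρ B := fun t ht => by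
    refine Metric.mem_cthickening_of_dist_le _ l ρ B hl ?_
    rw [dist_self_add_left, norm_smul, Real.norm_of_nonneg ht.1]
    exact (mul_le_mul (ht.2.trans hradius) (hBR l hl) (norm_nonneg _) (by positivity)).trans_eq
      (div_mul_cancel₀ ρ hR.ne')
  have hint : ∀ t ∈ Set.Icc 0 √(ε n),
      Integrable (fun ω => Real.exp (inner ℝ (l + t • l) (S' n (path X ω)))) P := fun t ht =>
    integrable_of_deltaTot_ne_top hX hn (hS n hn) (happ.1 n hn).1 hlim hBρ (hseg t ht) htop
      (hδ n hn)
  have hratio := moment_ratio_le hX hn (hS n hn) (happ.1 n hn).1 hlim hC2 hBρ hB.cthickening htop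
    (hδ n hn) (Real.sqrt_nonneg _) hquarter hx0 hseg (ha l hl) hx
  rw [Real.sq_sqrt (hεpos n hn).le] at hratio
  refine ⟨by simpa using hint 0 ⟨le_rfl, Real.sqrt_nonneg _⟩, ?_, hratio⟩
  simpa only [exp_inner_rpow] using hint _ ⟨Real.sqrt_nonneg _, le_rfl⟩

theorem HasNetEstimate.ae_eventually_forall_abs_sub_le [IsProbabilityMeasure P]
    (hnet : HasNetEstimate P X S k ε B)
    (hX : ∀ i, Measurable (X i)) (hstat : Stationary P X) (hS : ∀ n, 1 ≤ n → Measurable (S n))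
    (hk : ∀ n, 1 ≤ n → 0 < k n) (hB : IsCompact B) {ρ : ℝ} (hρ : 0 < ρ)
    {Λ : EuclideanSpace ℝ (Fin d) → ℝ}
    (hint : ∀ᶠ n in atTop, ∀ l ∈ Metric.thickening ρ B,
      Integrable (fun ω => Real.exp (inner ℝ l (S n (path X ω)))) P)
    (hlim : ∀ l ∈ Metric.thickening ρ B, Tendsto (fun n => realLambdaN P X S n l) atTop (𝓝 (Λ l)))
    (hεpos : ∀ n, 1 ≤ n → 0 < ε n) (hε : Tendsto ε atTop (𝓝 0)) {η : ℝ} (hη : 0 < η) :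
    ∀ᵐ ω ∂P, ∀ᶠ n in atTop, ∀ l ∈ B,
      |LambdaEmp X S k n ω l - realLambdaN P X S n l| ≤ η * ε n := by
  have hrate : Tendsto (fun n : ℕ => ε n * (1 + ε n) / n) atTop (𝓝 0) :=
    (hε.mul (hε.const_add 1)).div_atTop tendsto_natCast_atTop_atTop
  have hpoint : ∀ l ∈ B, ∀ᵐ ω ∂P, ∀ᶠ n in atTop,
      |LambdaEmp X S k n ω l - realLambdaN P X S n l| ≤ 1 := fun l hl => by
    filter_upwards [hnet.ae_eventually_abs_sub_le hεpos hε hl] with ω hω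
    filter_upwards [hω, hrate.eventually_le_const one_pos] with n hω hrate
    exact hω.trans hrate
  obtain ⟨s, hs, L, hlip⟩ :=
    exists_ae_eventually_abs_sub_le_mul_dist hX hstat hS hk hB hρ hint hlim hpoint
  obtain ⟨C, β, hC, hβ, N, hNB, hN⟩ := exists_finset_nets hB.isBounded hεpos hε
  simp only [finrank_euclideanSpace_fin] at hN
  filter_upwards [hnet C N hC hNB (hN.mono fun n hN => hN.1), hlip] with ω hω hlip
  exact eventually_forall_abs_sub_le_mul hεpos hε hs L.2 hβ hη (hN.mono fun n hN => hN.2) hω hlip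

end NetEstimate

end LocalFluct

theorem theorem2p4_general {Ω : Type*} [MeasurableSpace Ω] (P : Measure Ω) [IsProbabilityMeasure P]
    {E : Type*} [MeasurableSpace E] {d : ℕ}
    (X : ℕ → Ω → E) (hX : ∀ i, Measurable (X i)) (hstat : Stationary P X)
    (S S' : ℕ → (ℕ → E) → EuclideanSpace ℝ (Fin d)) (hS : ∀ n, 1 ≤ n → Measurable (S n))
    (k : ℕ → ℕ) (hkpos : ∀ n, 1 ≤ n → 0 < k n)
    (D : Set (EuclideanSpace ℝ (Fin d)))
    (hA1 : HasFiniteLimitOn P X S D)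
    (hA2 : StretchedExpMixing P X)
    (hA3 : LocalApprox S S')
    (hC2 : ContDiffOn ℝ 2 (LambdaReal P X S) D)
    (B : Set (EuclideanSpace ℝ (Fin d))) (hB : IsCompact B)
    (ρ : ℝ) (hρ : 0 < ρ) (hBρ : Metric.cthickening ρ B ⊆ D)
    (ε : ℕ → ℝ) (hεpos : ∀ n, 1 ≤ n → 0 < ε n) (hε : Tendsto ε atTop (𝓝 0))
    (hBC : ∑' n : ℕ, bcTerm P X S S' B (Metric.cthickening ρ B) k ε (n + 1) < ∞) :
    (∀ η : ℝ, 0 < η → ∀ᵐ ω ∂P, ∀ᶠ n : ℕ in atTop, ∀ l ∈ B,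
      ENNReal.ofReal |LambdaEmp X S k n ω l - LambdaReal P X S l| ≤
        ENNReal.ofReal (η * ε n) +
          deltaLambda P X S (Metric.cthickening ρ B) n + 2 * deltaPhi S S' B n) ∧
    (∀ l ∈ B, ∀ᵐ ω ∂P, ∀ᶠ n : ℕ in atTop,
      ENNReal.ofReal |LambdaEmp X S k n ω l - LambdaReal P X S l| ≤
        ENNReal.ofReal (ε n * (1 + ε n) / n) +
          deltaLambda P X S (Metric.cthickening ρ B) n + 2 * deltaPhi S S' B n) := by
  rcases B.eq_empty_or_nonempty with rfl | hne
  · simp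
  have hBK : B ⊆ Metric.cthickening ρ B := Metric.self_subset_cthickening B
  have hthick : Metric.thickening ρ B ⊆ Metric.cthickening ρ B :=
    Metric.thickening_subset_cthickening ρ B
  have hS' : ∀ n, 1 ≤ n → Measurable (S' n) := fun n hn => (hA3.1 n hn).1
  have htop := eventually_approxErr_ne_top hA3
  obtain ⟨a, x, ha, hax, hstar, hhess, hδ, hsum⟩ :=
    exists_summable_realBcTerm hX hS hA1 hC2 hne hBK hBρ hεpos hBC
  have hmom := eventually_hasMomentBound hX hS hA3 hA1 hC2 hB.isBounded hρ hBρ hεpos hε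
    (ha.trans hax) hstar hhess hδ
  have hnet : HasNetEstimate P X S' k ε B := fun C N hC hNB hN =>
    ae_eventually_abs_lambdaEmp_sub_le hX hstat hA2 hS' (fun n hn => (hA3.1 n hn).2) hkpos hεpos
      hε d.cast_nonneg ha hax (fun _ => ENNReal.toReal_nonneg) hsum hmom hC hNB hN
  refine ⟨fun η hη => ?_, fun l hl => ?_⟩
  · filter_upwards [hnet.ae_eventually_forall_abs_sub_le hX hstat hS' hkpos hB hρ
      ((eventually_forall_integrable_exp hX hS hA3 hA1 hBρ hδ).mono fun n h l hl => h l (hthick hl))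
      (fun l hl => tendsto_realLambdaN_of_localApprox hX hS hA3 hA1 (hBρ (hthick hl)))
      hεpos hε hη] with ω hω
    filter_upwards [hω, htop, eventually_ge_atTop 1] with n hω htop hn l hl
    exact ofReal_abs_lambdaEmp_sub_lambdaReal_le hX hn (hkpos n hn) (hS n hn) (hS' n hn) hA1 hBρ
      hBK hB.isBounded htop hl (hω l hl)
  · filter_upwards [hnet.ae_eventually_abs_sub_le hεpos hε hl] with ω hω
    filter_upwards [hω, htop, eventually_ge_atTop 1] with n hω htop hn
    exact ofReal_abs_lambdaEmp_sub_lambdaReal_le hX hn (hkpos n hn) (hS n hn) (hS' n hn) hA1 hBρ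
      hBK hB.isBounded htop hl hω

theorem theorem2p4 {Ω : Type*} [MeasurableSpace Ω] (P : Measure Ω) [IsProbabilityMeasure P]
    {E : Type*} [MeasurableSpace E] {d : ℕ} (hd : 1 ≤ d)
    (X : ℕ → Ω → E) (hX : ∀ i, Measurable (X i)) (hstat : Stationary P X)
    (S S' : ℕ → (ℕ → E) → EuclideanSpace ℝ (Fin d)) (hS : ∀ n, 1 ≤ n → Measurable (S n))
    (k : ℕ → ℕ) (hkpos : ∀ n, 1 ≤ n → 0 < k n) (hkmono : MonotoneOn k (Set.Ici 1))
    (D : Set (EuclideanSpace ℝ (Fin d)))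
    (hA1 : HasFiniteLimitOn P X S D)
    (hA2 : StretchedExpMixing P X)
    (hA3 : LocalApprox S S')
    (hC2 : ContDiffOn ℝ 2 (LambdaReal P X S) D)
    (B : Set (EuclideanSpace ℝ (Fin d))) (hB : IsCompact B)
    (ρ : ℝ) (hρ : 0 < ρ) (hBρ : Metric.cthickening ρ B ⊆ D)
    (ε : ℕ → ℝ) (hεpos : ∀ n, 1 ≤ n → 0 < ε n) (hε : Tendsto ε atTop (𝓝 0))
    (hBC : ∑' n : ℕ, bcTerm P X S S' B (Metric.cthickening ρ B) k ε (n + 1) < ∞) :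
    (∀ η : ℝ, 0 < η → ∀ᵐ ω ∂P, ∀ᶠ n : ℕ in atTop, ∀ l ∈ B,
      ENNReal.ofReal |LambdaEmp X S k n ω l - LambdaReal P X S l| ≤
        (ENNReal.ofReal η + 2 * xi1 P X S B) * ENNReal.ofReal (ε n) +
          deltaLambda P X S (Metric.cthickening ρ B) n + 2 * deltaPhi S S' B n) ∧
    (∀ l : EuclideanSpace ℝ (Fin d), B = {l} → ∀ᵐ ω ∂P, ∀ᶠ n : ℕ in atTop,
      ENNReal.ofReal |LambdaEmp X S k n ω l - LambdaReal P X S l| ≤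
        ENNReal.ofReal (ε n * (1 + ε n) / n) +
          deltaLambda P X S (Metric.cthickening ρ B) n + 2 * deltaPhi S S' B n) := by
  obtain ⟨hunif, hpoint⟩ := theorem2p4_general P X hX hstat S S' hS k hkpos D hA1 hA2 hA3 hC2 B hB
    ρ hρ hBρ ε hεpos hε hBC
  refine ⟨fun η hη => (hunif η hη).mono fun ω hω => hω.mono fun n hn l hl => (hn l hl).trans ?_,
    fun l hl => hpoint l (hl ▸ Set.mem_singleton l)⟩
  rw [ENNReal.ofReal_mul hη.le]
  gcongr
  exact le_self_add
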